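/- Setting. Let $\mathsf W$ be a nonempty standard Borel space and let $\mathsf X,\mathsf Y,\widehat{\mathsf Y}$ and the sample space $\mathsf D$ be measurable spaces. Given are: a prior $P_W$ on $\mathsf W$; a law $P_{Z^m|W}$ of the training data $Z^m\in\mathsf D^m$; an initial law $P_{X_1}$ on $\mathsf X$; observation-transition kernels $K_{X_{i}|X_{i-1},\widehat Y_{i-1}}$; a quantity-generation kernel $P_{Y|X,W}$; and a measurable loss $\ell:\mathsf X\times\mathsf Y\times\widehat{\mathsf Y}\to\mathbb R$. An offline-learned estimation strategy for $n$ rounds is a sequence of measurable maps $\psi_m^n=(\psi_{m,1},\dots,\psi_{m,n})$, with estimates $\widehat Y_i=\psi_{m,i}(Z^m,X^i,\widehat Y^{i-1})$. It determines the joint law of $(W,Z^m,X^n,Y^n,\widehat Y^n)$ in which $W\sim P_W$, $Z^m\sim P_{Z^m|W}$ and $X_1\sim P_{X_1}$ is independent of $(W,Z^m)$; given the past, $Y_i\sim P_{Y|X,W}(\cdot|X_i,W)$ and $X_{i+1}\sim K_{X_{i+1}|X_i,\widehat Y_i}$. Its inference loss is $\mathbb E[\sum_{i=1}^n\ell(X_i,Y_i,\widehat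 Y_i)]$. Let $\Delta$ be the space of probability distributions on $\mathsf W$ and $\pi_m=\mathbb P[W\in\cdot\,|Z^m]\in\Delta$ the posterior. A strategy is Markov if $\widehat Y_i=\psi_{m,i}(\pi_m,X_i)$ for measurable $\psi_{m,i}:\Delta\times\mathsf X\to\widehat{\mathsf Y}$. For a Markov strategy, the loss-to-go $$V_{m,i}(\pi,x;\psi_m^n)=\mathbb E\Big[\sum_{j=i}^n\ell(X_j,Y_j,\widehat Y_j)\,\Big|\,\pi_m=\pi,X_i=x\Big]$$ is defined for all $\pi\in\Delta$, $x\in\mathsf X$ as the expected loss of rounds $i,\dots,n$ when $W\sim\pi$, $X_i=x$ and $\widehat Y_j=\psi_{m,j}(\pi,X_j)$ for $j\ge i$. Expectations are $\mathbb E f^+-\mathbb E f^-$, with value $+\infty$ allowed. It is assumed that they are well defined: $\mathbb E[\ell(X_j,Y_j,\widehat Y_j)^-]<\infty$ in every round $j$, for every strategy under the joint law above, and for every Markov strategy when started in any round $i\le j$ with $W\sim\pi$, $X_i=x$, for any $\pi\in\Delta$, $x\in\mathsf X$ (for example, this holds if $\ell$ is bounded below). Let $\tilde\ell(\pi,x,\hat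 y)=\int_{\mathsf W}\int_{\mathsf Y}\ell(x,y,\hat y)\,P_{Y|X,W}(dy|x,w)\,\pi(dw)$ and define, for $i=n,\dots,1$, $$Q^*_{m,n}=\tilde\ell,\qquad Q^*_{m,i}(\pi,x,\hat y)=\tilde\ell(\pi,x,\hat y)+\mathbb E\big[V^*_{m,i+1}(\pi,X_{i+1})\,\big|\,X_i=x,\widehat Y_i=\hat y\big]\ (i<n),\qquad V^*_{m,i}(\pi,x)=\min_{\hat y}Q^*_{m,i}(\pi,x,\hat y).$$ Suppose the minima are attained and that $\psi^*_{m,i}:\Delta\times\mathsf X\to\widehat{\mathsf Y}$ are measurable with $\psi^*_{m,i}(\pi,x)\in\arg\min_{\hat y}Q^*_{m,i}(\pi,x,\hat y)$ for all $i,\pi,x$. Theorem. (1) The Markov strategy $(\psi^*_{m,1},\dots,\psi^*_{m,n})$ attains the minimum of the inference loss over all offline-learned estimation strategies. (2) For every Markov strategy $\psi_m^n$ and every $i$, the function $V_{m,i}(\cdot,\cdot\,;\psi_m^n)$ is measurable and is indeed a version of the above conditional expectation given $(\pi_m,X_i)$: for every measurable $S\subseteq\Delta\times\mathsf X$, $\mathbb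 E[\mathbf 1\{(\pi_m,X_i)\in S\}\sum_{j=i}^n\ell(X_j,Y_j,\widehat Y_j)]=\mathbb E[\mathbf 1\{(\pi_m,X_i)\in S\}V_{m,i}(\pi_m,X_i;\psi_m^n)]$. (3) For every Markov strategy $\psi_m^n$, every $i$ and all $\pi\in\Delta$, $x\in\mathsf X$, $$V_{m,i}(\pi,x;\psi_m^n)\ge V^*_{m,i}(\pi,x),$$ with equality if $\psi_{m,j}(\pi',x')=\psi^*_{m,j}(\pi',x')$ for all $\pi'\in\Delta$, $x'\in\mathsf X$ and $j\ge i$. -/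

import Mathlib

open MeasureTheory ProbabilityTheory
open scoped ENNReal

noncomputable section

namespace DynInf

/-- The expectation `E f⁺ - E f⁻` of an extended-real-valued function. -/
def expect {α : Type*} [MeasurableSpace α] (μ : Measure α) (f : α → EReal) : EReal :=
  ((∫⁻ a, (f a).toENNReal ∂μ : ℝ≥0∞) : EReal) - ((∫⁻ a, (-f a).toENNReal ∂μ : ℝ≥0∞) : EReal)

/-- The probabilistic models and the loss function of a dynamic inference problem with parameter
space `𝓦`, observations in `𝓧`, quantities of interest in `𝓨` and estimates in `𝓐`.
Rounds are numbered from `0`; `trans k` is the law of the observation in round `k + 1` given the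
observation and the estimate in round `k`, and `qty (x, w)` is the law of the quantity of interest
given the observation `x` and the parameter `w`. -/
structure Model (𝓦 𝓧 𝓨 𝓐 : Type*) [MeasurableSpace 𝓦] [MeasurableSpace 𝓧] [MeasurableSpace 𝓨]
    [MeasurableSpace 𝓐] where
  trans : ℕ → Kernel (𝓧 × 𝓐) 𝓧
  qty : Kernel (𝓧 × 𝓦) 𝓨
  loss : 𝓧 → 𝓨 → 𝓐 → ℝ
  isMarkovKernel_trans : ∀ k, IsMarkovKernel (trans k)
  isMarkovKernel_qty : IsMarkovKernel qty
  measurable_loss : Measurable fun p : 𝓧 × 𝓨 × 𝓐 => loss p.1 p.2.1 p.2.2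

/-- An estimation strategy learned from data in `𝓩`: in round `i` the estimate is a measurable
function of the data, the observations in rounds `0, …, i` and the estimates in rounds
`0, …, i - 1`. -/
structure Strategy (𝓩 𝓧 𝓐 : Type*) [MeasurableSpace 𝓩] [MeasurableSpace 𝓧]
    [MeasurableSpace 𝓐] where
  est : (i : ℕ) → 𝓩 × (Fin (i + 1) → 𝓧) × (Fin i → 𝓐) → 𝓐
  measurable_est : ∀ i, Measurable (est i)

/-- A Markov strategy: in round `i` the estimate is a measurable function of the posterior
distribution of the parameter and of the observation in round `i`. -/
structure MarkovStrategy (𝓦 𝓧 𝓐 : Type*) [MeasurableSpace 𝓦] [MeasurableSpace 𝓧]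
    [MeasurableSpace 𝓐] where
  est : ℕ → ProbabilityMeasure 𝓦 × 𝓧 → 𝓐
  measurable_est : ∀ i, Measurable (est i)

/-- The posterior distribution of the parameter given the data, as a point of the space of
probability distributions; `PW` is the prior and `PZ` is the law of the data given the
parameter. -/
def post {𝓦 𝓩 : Type*} [MeasurableSpace 𝓦] [MeasurableSpace 𝓩] [StandardBorelSpace 𝓦]
    [Nonempty 𝓦] (PW : Measure 𝓦) [IsProbabilityMeasure PW] (PZ : Kernel 𝓦 𝓩) [IsMarkovKernel PZ]
    (z : 𝓩) : ProbabilityMeasure 𝓦 :=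
  ⟨posterior PZ PW z, inferInstance⟩

theorem measurable_post {𝓦 𝓩 : Type*} [MeasurableSpace 𝓦] [MeasurableSpace 𝓩]
    [StandardBorelSpace 𝓦] [Nonempty 𝓦] (PW : Measure 𝓦) [IsProbabilityMeasure PW]
    (PZ : Kernel 𝓦 𝓩) [IsMarkovKernel PZ] : Measurable (post PW PZ) :=
  (Kernel.measurable (posterior PZ PW)).subtype_mk

section

variable {𝓦 𝓩 𝓧 𝓨 𝓐 : Type*} [MeasurableSpace 𝓦] [MeasurableSpace 𝓩] [MeasurableSpace 𝓧]
  [MeasurableSpace 𝓨] [MeasurableSpace 𝓐]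

/-- A Markov strategy as a learned strategy, where `g z` is the posterior given the data `z`. -/
def MarkovStrategy.toStrategy (ψ : MarkovStrategy 𝓦 𝓧 𝓐) (g : 𝓩 → ProbabilityMeasure 𝓦)
    (hg : Measurable g) : Strategy 𝓩 𝓧 𝓐 where
  est i h := ψ.est i (g h.1, h.2.1 (Fin.last i))
  measurable_est i := (ψ.measurable_est i).comp
    ((hg.comp measurable_fst).prodMk
      ((measurable_pi_apply (Fin.last i)).comp (measurable_fst.comp measurable_snd)))

/-- The Markov strategy used from round `i` on. -/
def MarkovStrategy.tail (ψ : MarkovStrategy 𝓦 𝓧 𝓐) (i : ℕ) : MarkovStrategy 𝓦 𝓧 𝓐 where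
  est k := ψ.est (i + k)
  measurable_est k := ψ.measurable_est (i + k)

namespace Model

/-- The model from round `i` on. -/
def tail (M : Model 𝓦 𝓧 𝓨 𝓐) (i : ℕ) : Model 𝓦 𝓧 𝓨 𝓐 where
  trans k := M.trans (i + k)
  qty := M.qty
  loss := M.loss
  isMarkovKernel_trans k := M.isMarkovKernel_trans (i + k)
  isMarkovKernel_qty := M.isMarkovKernel_qty
  measurable_loss := M.measurable_loss

/-- The law of the observation in round `k`, given the parameter, the data and the (observation,
quantity, estimate) triples of rounds `0, …, k - 1`; `ν` is the law of the initial observation. -/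
def obsKernel (M : Model 𝓦 𝓧 𝓨 𝓐) (𝓩 : Type*) [MeasurableSpace 𝓩] (ν : Measure 𝓧) :
    (k : ℕ) → Kernel ((𝓦 × 𝓩) × (Fin k → 𝓧 × 𝓨 × 𝓐)) 𝓧
  | 0 => Kernel.const _ ν
  | k + 1 => (M.trans k).comap
      (fun h => ((h.2 (Fin.last k)).1, (h.2 (Fin.last k)).2.2)) (by fun_prop)

/-- The law of the quantity of interest in round `k`, given the past and the observation in
round `k`. -/
def qtyKernel (M : Model 𝓦 𝓧 𝓨 𝓐) (𝓩 : Type*) [MeasurableSpace 𝓩] (k : ℕ) :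
    Kernel (((𝓦 × 𝓩) × (Fin k → 𝓧 × 𝓨 × 𝓐)) × 𝓧) 𝓨 :=
  M.qty.comap (fun p => (p.2, p.1.1.1)) (by fun_prop)

/-- The estimate made in round `k` from the past `h` and the observation `x` in round `k`. -/
def estimate {k : ℕ} (ψ : Strategy 𝓩 𝓧 𝓐) (h : (𝓦 × 𝓩) × (Fin k → 𝓧 × 𝓨 × 𝓐)) (x : 𝓧) : 𝓐 :=
  ψ.est k (h.1.2, Fin.snoc (α := fun _ => 𝓧) (fun j => (h.2 j).1) x, fun j => (h.2 j).2.2)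

/-- The joint law of the parameter, the data and the (observation, quantity, estimate) triples of
the first `k` rounds, when the parameter and the data have joint law `μ`, the initial observation
has law `ν`, and the strategy `ψ` is used. -/
def law (M : Model 𝓦 𝓧 𝓨 𝓐) (μ : Measure (𝓦 × 𝓩)) (ν : Measure 𝓧) (ψ : Strategy 𝓩 𝓧 𝓐) :
    (k : ℕ) → Measure ((𝓦 × 𝓩) × (Fin k → 𝓧 × 𝓨 × 𝓐))
  | 0 => μ.map fun a => (a, Fin.elim0)
  | k + 1 => ((M.law μ ν ψ k ⊗ₘ M.obsKernel 𝓩 ν k) ⊗ₘ M.qtyKernel 𝓩 k).map fun p =>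
      (p.1.1.1, Fin.snoc (α := fun _ => 𝓧 × 𝓨 × 𝓐) p.1.1.2
        (p.1.2, p.2, estimate ψ p.1.1 p.1.2))

/-- The loss incurred in one round. -/
def roundLoss (M : Model 𝓦 𝓧 𝓨 𝓐) (r : 𝓧 × 𝓨 × 𝓐) : ℝ := M.loss r.1 r.2.1 r.2.2

/-- The expected loss accumulated over the first `n` rounds. -/
def inferenceLoss (M : Model 𝓦 𝓧 𝓨 𝓐) (n : ℕ) (μ : Measure (𝓦 × 𝓩)) (ν : Measure 𝓧)
    (ψ : Strategy 𝓩 𝓧 𝓐) : EReal :=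
  expect (M.law μ ν ψ n) fun ω => ((∑ j, M.roundLoss (ω.2 j) : ℝ) : EReal)

/-- In each of the first `n` rounds, the negative part of the loss has finite expectation. -/
def NegPartIntegrable (M : Model 𝓦 𝓧 𝓨 𝓐) (n : ℕ) (μ : Measure (𝓦 × 𝓩)) (ν : Measure 𝓧)
    (ψ : Strategy 𝓩 𝓧 𝓐) : Prop :=
  ∀ j : Fin n, ∫⁻ ω, ENNReal.ofReal (-M.roundLoss (ω.2 j)) ∂(M.law μ ν ψ n) ≠ ∞

/-- The part of the strategy `ψ` from round `i` on, when the posterior is known to be `π`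
(there are no other data). -/
def tailStrategy (ψ : MarkovStrategy 𝓦 𝓧 𝓐) (i : ℕ) (π : ProbabilityMeasure 𝓦) :
    Strategy Unit 𝓧 𝓐 :=
  (ψ.tail i).toStrategy (fun _ => π) measurable_const

/-- The joint law of the parameter and the (absent) data, when the posterior is known to be `π`. -/
def beliefLaw (π : ProbabilityMeasure 𝓦) : Measure (𝓦 × Unit) :=
  (π : Measure 𝓦).prod (Measure.dirac ())

/-- The loss-to-go `V_i(π, x; ψ)` of a Markov strategy: the expected loss accumulated from round
`i` to the last of the `n` rounds, given that the posterior is `π` and that the observation in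
round `i` is `x`. -/
def lossToGo (M : Model 𝓦 𝓧 𝓨 𝓐) (n : ℕ) (ψ : MarkovStrategy 𝓦 𝓧 𝓐) (i : ℕ)
    (π : ProbabilityMeasure 𝓦) (x : 𝓧) : EReal :=
  (M.tail i).inferenceLoss (n - i) (beliefLaw π) (Measure.dirac x) (tailStrategy ψ i π)

/-- The loss averaged over the quantity of interest and over the parameter, with law `π`. -/
def avgLoss (M : Model 𝓦 𝓧 𝓨 𝓐) (π : ProbabilityMeasure 𝓦) (x : 𝓧) (a : 𝓐) : EReal :=
  expect (π : Measure 𝓦) fun w => expect (M.qty (x, w)) fun y => ((M.loss x y a : ℝ) : EReal)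

/-- The function `Q*_i` of the backward dynamic programming recursion for `n` rounds. -/
def Qstar (M : Model 𝓦 𝓧 𝓨 𝓐) (n i : ℕ) (π : ProbabilityMeasure 𝓦) (x : 𝓧) (a : 𝓐) : EReal :=
  if i + 1 < n then
    M.avgLoss π x a + expect (M.trans i (x, a)) fun x' => ⨅ a' : 𝓐, M.Qstar n (i + 1) π x' a'
  else M.avgLoss π x a
termination_by n - i

/-- The function `V*_i` of the backward dynamic programming recursion for `n` rounds. -/
def Vstar (M : Model 𝓦 𝓧 𝓨 𝓐) (n i : ℕ) (π : ProbabilityMeasure 𝓦) (x : 𝓧) : EReal :=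
  ⨅ a : 𝓐, M.Qstar n i π x a

end Model

end

end DynInf

end

/-!
A strategy never sees the quantities of interest, and the observations evolve without reference to
the parameter. Hence, given the data, the parameter is independent of the visible history, that is,
of the observations and the estimates (`lintegral_law_resample`). The expected loss of a round,
given all that is visible in it, is therefore the loss averaged over the posterior
(`lintegral_law_cost`), and the pair of the posterior and the current observation is a Markov chain
controlled by the estimates.

Losses may have infinite expectation, so the positive and the negative part of the loss are treated
separately as nonnegative costs. For such a cost and a Markov strategy, `costToGo` is given by a
backward recursion, and `lintegral_law_costToGo` shows that it is the conditional expectation of the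
cost accumulated from a round on, for every strategy that follows the Markov strategy from this
round on. Applied to the process that starts from a known posterior, this expresses the loss-to-go
as the difference of two costs-to-go (`lossToGo_eq`); applied to the original process, it identifies
the loss-to-go as a conditional expectation (`expect_restrict_lossToGo`). The subtracted cost is finite
by assumption, so differences and expectations may be exchanged (`expect_coe_sub_coe`).

The recursion for the loss-to-go (`lossToGo_eq_add`) and backward induction compare it with the
dynamic programming value (`Vstar_le_lossToGo`, `lossToGo_eq_Vstar`). For the optimality among all
strategies, an arbitrary strategy is followed before round `i` and the strategy of dynamic
programming from round `i` on. The expected loss of this combination is nondecreasing in `i`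
(`switchCost_sub_le_succ`), because an arbitrary estimate in round `i` followed by optimal ones is
no better than an optimal estimate in round `i`.
-/

/-! ### Extended-real expectations -/

namespace DynInf

/-- Cross-addition of nonnegative quantities turned into an equality of differences. -/
theorem coe_sub_coe_eq_of_add_eq {a b p q : ℝ≥0∞} (hb : b ≠ ∞) (hq : q ≠ ∞)
    (h : a + q = b + p) : (a : EReal) - b = (p : EReal) - q := by
  lift b to NNReal using hb
  lift q to NNReal using hq
  induction p with
  | top =>
    have ha : a = ∞ := by simpa using h
    subst ha
    simp [EReal.coe_ennreal_top]
  | coe p =>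
    have ha : a ≠ ∞ := by
      rintro rfl
      simp [← ENNReal.coe_add] at h
    lift a to NNReal using ha
    norm_cast at h
    have h' : (a : ℝ) + q = b + p := by exact_mod_cast h
    change ((a : ℝ) : EReal) - ((b : ℝ) : EReal) = ((p : ℝ) : EReal) - ((q : ℝ) : EReal)
    norm_cast
    linarith

theorem coe_add_sub_coe_add {a b c d : ℝ≥0∞} (hc : c ≠ ∞) (hd : d ≠ ∞) :
    ((a + b : ℝ≥0∞) : EReal) - ((c + d : ℝ≥0∞) : EReal)
      = ((a : EReal) - c) + ((b : EReal) - d) := by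
  lift c to NNReal using hc
  lift d to NNReal using hd
  induction a with
  | top =>
    induction b with
    | top =>
      simp only [top_add, EReal.coe_ennreal_top, ← ENNReal.coe_add]
      change (⊤ : EReal) - (((c + d : NNReal) : ℝ) : EReal) =
        ⊤ - ((c : ℝ) : EReal) + (⊤ - ((d : ℝ) : EReal))
      simp only [EReal.top_sub_coe, EReal.top_add_top]
    | coe b =>
      simp only [top_add, EReal.coe_ennreal_top, ← ENNReal.coe_add]
      change (⊤ : EReal) - (((c + d : NNReal) : ℝ) : EReal) =
        ⊤ - ((c : ℝ) : EReal) + (((b : ℝ) : EReal) - ((d : ℝ) : EReal))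
      simp only [EReal.top_sub_coe, ← EReal.coe_sub, EReal.top_add_coe]
  | coe a =>
    induction b with
    | top =>
      simp only [add_top, EReal.coe_ennreal_top, ← ENNReal.coe_add]
      change (⊤ : EReal) - (((c + d : NNReal) : ℝ) : EReal) =
        (((a : ℝ) : EReal) - ((c : ℝ) : EReal)) + (⊤ - ((d : ℝ) : EReal))
      simp only [EReal.top_sub_coe, ← EReal.coe_sub, EReal.coe_add_top]
    | coe b =>
      rw [← ENNReal.coe_add, ← ENNReal.coe_add]
      change (((a + b : NNReal) : ℝ) : EReal) - (((c + d : NNReal) : ℝ) : EReal) =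
        (((a : ℝ) : EReal) - ((c : ℝ) : EReal)) + (((b : ℝ) : EReal) - ((d : ℝ) : EReal))
      norm_cast
      push_cast
      ring

variable {α : Type*} [MeasurableSpace α]

theorem expect_mono {μ : Measure α} {f g : α → EReal} (h : ∀ a, f a ≤ g a) :
    expect μ f ≤ expect μ g := by
  unfold expect
  refine EReal.sub_le_sub ?_ ?_
  · exact_mod_cast lintegral_mono fun a => EReal.toENNReal_le_toENNReal (h a)
  · exact_mod_cast lintegral_mono fun a =>
      EReal.toENNReal_le_toENNReal (EReal.neg_le_neg_iff.2 (h a))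

/-- The expectation of a difference of nonnegative functions may be computed termwise when the
subtracted function is integrable; that function need not be the negative part of the difference. -/
theorem expect_coe_sub_coe {μ : Measure α} {P N : α → ℝ≥0∞} (hP : Measurable P)
    (hN : Measurable N) (hfin : ∫⁻ a, N a ∂μ ≠ ∞) :
    expect μ (fun a => (P a : EReal) - N a)
      = ((∫⁻ a, P a ∂μ : ℝ≥0∞) : EReal) - ((∫⁻ a, N a ∂μ : ℝ≥0∞) : EReal) := by
  have hpos : ∀ a, ((P a : EReal) - N a).toENNReal = P a - N a := fun a => by
    rw [EReal.toENNReal_sub (EReal.coe_ennreal_nonneg _), EReal.toENNReal_coe,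
      EReal.toENNReal_coe]
  have hneg : ∀ᵐ a ∂μ, (-((P a : EReal) - N a)).toENNReal = N a - P a := by
    filter_upwards [ae_lt_top hN hfin] with a ha
    rw [EReal.neg_sub (Or.inl (EReal.coe_ennreal_ne_bot _))
      (Or.inr (by simpa using ha.ne)), add_comm, ← sub_eq_add_neg,
      EReal.toENNReal_sub (EReal.coe_ennreal_nonneg _), EReal.toENNReal_coe,
      EReal.toENNReal_coe]
  unfold expect
  simp only [hpos]
  rw [lintegral_congr_ae hneg]
  refine coe_sub_coe_eq_of_add_eq ?_ hfin ?_
  · exact ne_top_of_le_ne_top hfin (lintegral_mono fun a => tsub_le_self)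
  · rw [← lintegral_add_right _ hN, ← lintegral_add_right _ hP]
    refine lintegral_congr fun a => ?_
    rw [tsub_add_eq_max, tsub_add_eq_max, max_comm]

theorem coe_sum_eq_coe_sub_coe {ι : Type*} (s : Finset ι) (f : ι → ℝ) :
    ((∑ j ∈ s, f j : ℝ) : EReal) = ((∑ j ∈ s, ENNReal.ofReal (f j) : ℝ≥0∞) : EReal)
      - ((∑ j ∈ s, ENNReal.ofReal (-f j) : ℝ≥0∞) : EReal) := by
  classical
  induction s using Finset.induction_on with
  | empty => simp
  | insert j s hj ih =>
    rw [Finset.sum_insert hj, Finset.sum_insert hj, Finset.sum_insert hj, coe_add_sub_coe_add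
      ENNReal.ofReal_ne_top (ENNReal.sum_ne_top.2 fun _ _ => ENNReal.ofReal_ne_top), ← ih,
      EReal.coe_add, EReal.coe_ennreal_ofReal, EReal.coe_ennreal_ofReal]
    congr 1
    norm_cast
    rcases le_total 0 (f j) with h | h <;> simp [h]

theorem expect_coe_sum {ι : Type*} {μ : Measure α} (s : Finset ι) {f : ι → α → ℝ}
    (hf : ∀ j, Measurable (f j)) (hfin : ∀ j, ∫⁻ a, ENNReal.ofReal (-f j a) ∂μ ≠ ∞) :
    expect μ (fun a => ((∑ j ∈ s, f j a : ℝ) : EReal))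
      = ((∫⁻ a, ∑ j ∈ s, ENNReal.ofReal (f j a) ∂μ : ℝ≥0∞) : EReal)
        - ((∫⁻ a, ∑ j ∈ s, ENNReal.ofReal (-f j a) ∂μ : ℝ≥0∞) : EReal) := by
  simp only [coe_sum_eq_coe_sub_coe s]
  refine expect_coe_sub_coe (by fun_prop) (by fun_prop) ?_
  rw [lintegral_finsetSum _ (by fun_prop)]
  exact ENNReal.sum_ne_top.2 fun j _ => hfin j

end DynInf

/-! ### The law of the process -/

namespace DynInf

theorem measurable_lintegral_kernel {α β γ : Type*} [MeasurableSpace α] [MeasurableSpace β]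
    [MeasurableSpace γ] (κ : Kernel β γ) [IsSFiniteKernel κ] {φ : α → β} (hφ : Measurable φ)
    {F : α → γ → ℝ≥0∞} (hF : Measurable fun p : α × γ => F p.1 p.2) :
    Measurable fun a => ∫⁻ y, F a y ∂κ (φ a) :=
  Measurable.lintegral_kernel_prod_right (κ := κ.comap φ hφ) hF

theorem measurable_finSnoc {α β : Type*} [MeasurableSpace α] [MeasurableSpace β] {k : ℕ}
    {f : β → Fin k → α} {g : β → α} (hf : Measurable f) (hg : Measurable g) :
    Measurable fun b => (Fin.snoc (α := fun _ => α) (f b) (g b) : Fin (k + 1) → α) := by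
  refine measurable_pi_lambda _ fun j => ?_
  refine Fin.lastCases ?_ (fun j => ?_) j
  · simpa using hg
  · simpa only [Fin.snoc_castSucc] using! (measurable_pi_apply j).comp hf

/-- The kernel that samples a parameter from a given distribution. -/
noncomputable def sampleKernel (𝓦 : Type*) [MeasurableSpace 𝓦] :
    Kernel (ProbabilityMeasure 𝓦) 𝓦 where
  toFun π := π
  measurable' := measurable_subtype_coe

instance (𝓦 : Type*) [MeasurableSpace 𝓦] : IsMarkovKernel (sampleKernel 𝓦) :=
  ⟨fun π => inferInstanceAs (IsProbabilityMeasure (π : Measure 𝓦))⟩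

theorem measurable_lintegral_probabilityMeasure {α 𝓦 : Type*} [MeasurableSpace α]
    [MeasurableSpace 𝓦] {φ : α → ProbabilityMeasure 𝓦} (hφ : Measurable φ)
    {F : α → 𝓦 → ℝ≥0∞} (hF : Measurable fun p : α × 𝓦 => F p.1 p.2) :
    Measurable fun a => ∫⁻ w, F a w ∂(φ a : Measure 𝓦) :=
  measurable_lintegral_kernel (sampleKernel 𝓦) hφ hF

variable {𝓦 𝓩 𝓧 𝓨 𝓐 : Type*} [MeasurableSpace 𝓦] [MeasurableSpace 𝓩] [MeasurableSpace 𝓧]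
  [MeasurableSpace 𝓨] [MeasurableSpace 𝓐]

/-- The part of a history that is visible to a strategy: the quantities of interest are erased. -/
def visible {𝓧 𝓨 𝓐 : Type*} {k : ℕ} (h : Fin k → 𝓧 × 𝓨 × 𝓐) : Fin k → 𝓧 × 𝓐 :=
  fun j => ((h j).1, (h j).2.2)

@[fun_prop]
theorem measurable_visible {k : ℕ} :
    Measurable (visible : (Fin k → 𝓧 × 𝓨 × 𝓐) → Fin k → 𝓧 × 𝓐) := by
  unfold visible; fun_prop

theorem visible_snoc {𝓧 𝓨 𝓐 : Type*} {k : ℕ} (h : Fin k → 𝓧 × 𝓨 × 𝓐) (t : 𝓧 × 𝓨 × 𝓐) :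
    visible (Fin.snoc (α := fun _ => 𝓧 × 𝓨 × 𝓐) h t : Fin (k + 1) → 𝓧 × 𝓨 × 𝓐)
      = Fin.snoc (α := fun _ => 𝓧 × 𝓐) (visible h) (t.1, t.2.2) := by
  funext j
  refine Fin.lastCases ?_ (fun j => ?_) j <;> simp [visible]

/-- The first `i` entries of a history of length `n`. -/
def truncate {α : Type*} {i n : ℕ} (hi : i ≤ n) (h : Fin n → α) : Fin i → α :=
  fun j => h (Fin.castLE hi j)

@[fun_prop]
theorem measurable_truncate {α : Type*} [MeasurableSpace α] {i n : ℕ} (hi : i ≤ n) :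
    Measurable (truncate hi : (Fin n → α) → Fin i → α) := by
  unfold truncate; fun_prop

theorem truncate_snoc {α : Type*} {i k : ℕ} (hi : i ≤ k) (h : Fin k → α) (t : α) :
    truncate (Nat.le_succ_of_le hi) (Fin.snoc (α := fun _ => α) h t : Fin (k + 1) → α)
      = truncate hi h := by
  funext j
  exact Fin.snoc_castSucc (α := fun _ => α) t h (Fin.castLE hi j)

theorem truncate_self {α : Type*} {k : ℕ} (h : Fin k → α) : truncate le_rfl h = h := rfl

/-- The estimate that a strategy makes from the data, the visible history and the current
observation. -/
def Strategy.act (φ : Strategy 𝓩 𝓧 𝓐) {k : ℕ} (z : 𝓩) (r : Fin k → 𝓧 × 𝓐) (x : 𝓧) : 𝓐 :=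
  φ.est k (z, Fin.snoc (α := fun _ => 𝓧) (fun j => (r j).1) x, fun j => (r j).2)

theorem Strategy.measurable_act {α : Type*} [MeasurableSpace α] (φ : Strategy 𝓩 𝓧 𝓐) {k : ℕ}
    {z : α → 𝓩} {r : α → Fin k → 𝓧 × 𝓐} {x : α → 𝓧} (hz : Measurable z) (hr : Measurable r)
    (hx : Measurable x) : Measurable fun a => φ.act (z a) (r a) (x a) := by
  refine (φ.measurable_est k).comp (hz.prodMk ((measurable_finSnoc ?_ hx).prodMk ?_)) <;> fun_prop

namespace Model

instance (M : Model 𝓦 𝓧 𝓨 𝓐) (k : ℕ) : IsMarkovKernel (M.trans k) := M.isMarkovKernel_trans k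

instance (M : Model 𝓦 𝓧 𝓨 𝓐) : IsMarkovKernel M.qty := M.isMarkovKernel_qty

instance (M : Model 𝓦 𝓧 𝓨 𝓐) (ν : Measure 𝓧) [IsProbabilityMeasure ν] (k : ℕ) :
    IsMarkovKernel (M.obsKernel 𝓩 ν k) := by
  cases k <;> unfold obsKernel <;> infer_instance

instance (M : Model 𝓦 𝓧 𝓨 𝓐) (k : ℕ) : IsMarkovKernel (M.qtyKernel 𝓩 k) := by
  unfold qtyKernel; infer_instance

/-- The law of the observation in round `k` given the visible history. -/
noncomputable def nextObs (M : Model 𝓦 𝓧 𝓨 𝓐) (ν : Measure 𝓧) :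
    (k : ℕ) → Kernel (Fin k → 𝓧 × 𝓐) 𝓧
  | 0 => Kernel.const _ ν
  | k + 1 => (M.trans k).comap (fun r => r (Fin.last k)) (by fun_prop)

instance (M : Model 𝓦 𝓧 𝓨 𝓐) (ν : Measure 𝓧) [IsProbabilityMeasure ν] (k : ℕ) :
    IsMarkovKernel (M.nextObs ν k) := by
  cases k <;> unfold nextObs <;> infer_instance

theorem obsKernel_apply (M : Model 𝓦 𝓧 𝓨 𝓐) (ν : Measure 𝓧) (k : ℕ)
    (p : (𝓦 × 𝓩) × (Fin k → 𝓧 × 𝓨 × 𝓐)) :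
    M.obsKernel 𝓩 ν k p = M.nextObs ν k (visible p.2) := by
  cases k <;> rfl

theorem nextObs_succ_snoc (M : Model 𝓦 𝓧 𝓨 𝓐) (ν : Measure 𝓧) (k : ℕ) (r : Fin k → 𝓧 × 𝓐)
    (t : 𝓧 × 𝓐) :
    M.nextObs ν (k + 1) (Fin.snoc (α := fun _ => 𝓧 × 𝓐) r t) = M.trans k t := by
  simp [nextObs, Kernel.comap_apply]

/-- The law of the first `k` rounds depends only on the estimates of the strategy in those
rounds. -/
theorem law_congr (M : Model 𝓦 𝓧 𝓨 𝓐) (μ : Measure (𝓦 × 𝓩)) (ν : Measure 𝓧)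
    {φ φ' : Strategy 𝓩 𝓧 𝓐} (k : ℕ) (h : ∀ j < k, φ.est j = φ'.est j) :
    M.law μ ν φ k = M.law μ ν φ' k := by
  induction k with
  | zero => rfl
  | succ k ih =>
    unfold law
    rw [ih fun j hj => h j (hj.trans k.lt_succ_self)]
    simp only [estimate, h k k.lt_succ_self]

theorem lintegral_law_zero (M : Model 𝓦 𝓧 𝓨 𝓐) (μ : Measure (𝓦 × 𝓩)) (ν : Measure 𝓧)
    (φ : Strategy 𝓩 𝓧 𝓐)
    {F : (𝓦 × 𝓩) × (Fin 0 → 𝓧 × 𝓨 × 𝓐) → ℝ≥0∞} (hF : Measurable F) :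
    ∫⁻ p, F p ∂M.law μ ν φ 0 = ∫⁻ a, F (a, Fin.elim0) ∂μ := by
  exact lintegral_map hF (Measurable.prodMk measurable_id measurable_const)

variable (M : Model 𝓦 𝓧 𝓨 𝓐) (μ : Measure (𝓦 × 𝓩)) [IsProbabilityMeasure μ] (ν : Measure 𝓧)
  [IsProbabilityMeasure ν]

theorem measurable_snoc_estimate (φ : Strategy 𝓩 𝓧 𝓐) (k : ℕ) :
    Measurable fun p : (((𝓦 × 𝓩) × (Fin k → 𝓧 × 𝓨 × 𝓐)) × 𝓧) × 𝓨 =>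
      (p.1.1.1, (Fin.snoc (α := fun _ => 𝓧 × 𝓨 × 𝓐) p.1.1.2
        (p.1.2, p.2, estimate φ p.1.1 p.1.2) : Fin (k + 1) → 𝓧 × 𝓨 × 𝓐)) := by
  refine Measurable.prodMk (by fun_prop) (measurable_finSnoc (by fun_prop) ?_)
  refine Measurable.prodMk (by fun_prop) (Measurable.prodMk (by fun_prop) ?_)
  exact φ.measurable_act (z := fun p : (((𝓦 × 𝓩) × (Fin k → 𝓧 × 𝓨 × 𝓐)) × 𝓧) × 𝓨 => p.1.1.1.2)
    (r := fun p => visible p.1.1.2) (x := fun p => p.1.2)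
    (by fun_prop) (by fun_prop) (by fun_prop)

instance (φ : Strategy 𝓩 𝓧 𝓐) (k : ℕ) : IsProbabilityMeasure (M.law μ ν φ k) := by
  induction k with
  | zero =>
    unfold law
    exact Measure.isProbabilityMeasure_map
      (Measurable.prodMk measurable_id measurable_const).aemeasurable
  | succ k ih =>
    unfold law
    exact Measure.isProbabilityMeasure_map (measurable_snoc_estimate φ k).aemeasurable

theorem lintegral_law_succ (φ : Strategy 𝓩 𝓧 𝓐) (k : ℕ)
    {F : (𝓦 × 𝓩) × (Fin (k + 1) → 𝓧 × 𝓨 × 𝓐) → ℝ≥0∞} (hF : Measurable F) :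
    ∫⁻ p, F p ∂M.law μ ν φ (k + 1) =
      ∫⁻ p, ∫⁻ x, ∫⁻ y, F (p.1, Fin.snoc (α := fun _ => 𝓧 × 𝓨 × 𝓐) p.2
        (x, y, φ.act p.1.2 (visible p.2) x)) ∂M.qty (x, p.1.1)
        ∂M.nextObs ν k (visible p.2) ∂M.law μ ν φ k := by
  have hG : Measurable fun p : (((𝓦 × 𝓩) × (Fin k → 𝓧 × 𝓨 × 𝓐)) × 𝓧) × 𝓨 =>
      F (p.1.1.1, Fin.snoc (α := fun _ => 𝓧 × 𝓨 × 𝓐) p.1.1.2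
        (p.1.2, p.2, estimate φ p.1.1 p.1.2)) := hF.comp (measurable_snoc_estimate φ k)
  rw [law, lintegral_map hF (measurable_snoc_estimate φ k), Measure.lintegral_compProd hG,
    Measure.lintegral_compProd hG.lintegral_kernel_prod_right']
  simp only [obsKernel_apply]
  rfl

/-- The law of the first rounds is a marginal of the law of all the rounds. -/
theorem lintegral_law_truncate (φ : Strategy 𝓩 𝓧 𝓐) {i n : ℕ} (hi : i ≤ n)
    {F : (𝓦 × 𝓩) × (Fin i → 𝓧 × 𝓨 × 𝓐) → ℝ≥0∞} (hF : Measurable F) :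
    ∫⁻ p, F (p.1, truncate hi p.2) ∂M.law μ ν φ n = ∫⁻ p, F p ∂M.law μ ν φ i := by
  induction n, hi using Nat.le_induction with
  | base => rfl
  | succ n hn ih =>
    rw [lintegral_law_succ _ _ _ _ _ (by fun_prop), ← ih]
    refine lintegral_congr fun p => ?_
    -- the integrand does not involve round `n`
    simp only [truncate_snoc hn, lintegral_const, measure_univ, mul_one]

/-! ### Conditional independence of the parameter and the visible history -/

/-- `g` is a version of the conditional distribution of the parameter given the data when the
parameter and the data have joint law `μ`: the parameter may be resampled from `g`. -/
def IsPosterior (μ : Measure (𝓦 × 𝓩)) (g : 𝓩 → ProbabilityMeasure 𝓦) : Prop :=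
  ∀ G : 𝓦 × 𝓩 → ℝ≥0∞, Measurable G →
    ∫⁻ a, G a ∂μ = ∫⁻ a, ∫⁻ w, G (w, a.2) ∂(g a.2 : Measure 𝓦) ∂μ

/-- Given the data, the parameter is independent of the visible history. This is so because
strategies do not see the quantities of interest and the observations evolve without reference to
the parameter. -/
theorem lintegral_law_resample {g : 𝓩 → ProbabilityMeasure 𝓦} (hg : Measurable g)
    {μ : Measure (𝓦 × 𝓩)} [IsProbabilityMeasure μ] (hμ : IsPosterior μ g) (φ : Strategy 𝓩 𝓧 𝓐)
    (k : ℕ) {G : 𝓦 × 𝓩 × (Fin k → 𝓧 × 𝓐) → ℝ≥0∞} (hG : Measurable G) :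
    ∫⁻ p, G (p.1.1, p.1.2, visible p.2) ∂M.law μ ν φ k =
      ∫⁻ p, ∫⁻ w, G (w, p.1.2, visible p.2) ∂(g p.1.2 : Measure 𝓦) ∂M.law μ ν φ k := by
  induction k with
  | zero =>
    rw [lintegral_law_zero _ _ _ _ (by fun_prop), lintegral_law_zero]
    · exact hμ (fun a => G (a.1, a.2, visible (Fin.elim0 : Fin 0 → 𝓧 × 𝓨 × 𝓐))) (by fun_prop)
    · exact measurable_lintegral_probabilityMeasure (by fun_prop) (by fun_prop)
  | succ k ih =>
    have hsnoc : Measurable fun q : (𝓦 × 𝓩 × (Fin k → 𝓧 × 𝓐)) × 𝓧 =>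
        G (q.1.1, q.1.2.1, Fin.snoc (α := fun _ => 𝓧 × 𝓐) q.1.2.2
          (q.2, φ.act q.1.2.1 q.1.2.2 q.2)) := by
      refine hG.comp (Measurable.prodMk (by fun_prop) (Measurable.prodMk (by fun_prop)
        (measurable_finSnoc (by fun_prop) (Measurable.prodMk (by fun_prop) ?_))))
      exact φ.measurable_act (by fun_prop) (by fun_prop) (by fun_prop)
    rw [lintegral_law_succ _ _ _ _ _ (by fun_prop), lintegral_law_succ]
    · simp only [visible_snoc, lintegral_const, measure_univ, mul_one]
      rw [ih (G := fun q => ∫⁻ x, G (q.1, q.2.1, Fin.snoc (α := fun _ => 𝓧 × 𝓐) q.2.2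
        (x, φ.act q.2.1 q.2.2 x)) ∂M.nextObs ν k q.2.2)
        (measurable_lintegral_kernel (M.nextObs ν k) (by fun_prop) hsnoc)]
      refine lintegral_congr fun p => ?_
      rw [lintegral_lintegral_swap]
      refine Measurable.aemeasurable ?_
      exact hsnoc.comp (f := fun q : 𝓧 × 𝓦 => ((q.2, p.1.2, visible p.2), q.1))
        (by fun_prop)
    · exact measurable_lintegral_probabilityMeasure (by fun_prop) (by fun_prop)

end Model

end DynInf

/-! ### Nonnegative costs of Markov strategies -/

namespace DynInf

namespace Model

variable {𝓦 𝓩 𝓧 𝓨 𝓐 : Type*} [MeasurableSpace 𝓦] [MeasurableSpace 𝓩] [MeasurableSpace 𝓧]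
  [MeasurableSpace 𝓨] [MeasurableSpace 𝓐] (M : Model 𝓦 𝓧 𝓨 𝓐)

/-- The nonnegative cost `f` of one round averaged over the quantity of interest and over the
parameter, with law `π`. -/
noncomputable def meanCost (f : 𝓧 × 𝓨 × 𝓐 → ℝ≥0∞) (π : ProbabilityMeasure 𝓦) (x : 𝓧) (a : 𝓐) :
    ℝ≥0∞ :=
  ∫⁻ w, ∫⁻ y, f (x, y, a) ∂M.qty (x, w) ∂(π : Measure 𝓦)

/-- The expected accumulated cost `f` over `r` rounds from round `i` on, for the posterior `π` and
the observation `x` in round `i`. -/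
noncomputable def costToGo (f : 𝓧 × 𝓨 × 𝓐 → ℝ≥0∞) (ψ : MarkovStrategy 𝓦 𝓧 𝓐) :
    ℕ → ℕ → ProbabilityMeasure 𝓦 → 𝓧 → ℝ≥0∞
  | 0, _, _, _ => 0
  | r + 1, i, π, x => M.meanCost f π x (ψ.est i (π, x)) +
      ∫⁻ x', costToGo f ψ r (i + 1) π x' ∂M.trans i (x, ψ.est i (π, x))

theorem measurable_meanCost {f : 𝓧 × 𝓨 × 𝓐 → ℝ≥0∞} (hf : Measurable f) :
    Measurable fun q : ProbabilityMeasure 𝓦 × 𝓧 × 𝓐 => M.meanCost f q.1 q.2.1 q.2.2 :=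
  measurable_lintegral_probabilityMeasure measurable_fst
    (measurable_lintegral_kernel M.qty
      (φ := fun q : (ProbabilityMeasure 𝓦 × 𝓧 × 𝓐) × 𝓦 => (q.1.2.1, q.2)) (by fun_prop)
      (by fun_prop))

theorem measurable_lintegral_trans {f : ProbabilityMeasure 𝓦 → 𝓧 → ℝ≥0∞} (i : ℕ)
    (hf : Measurable fun q : ProbabilityMeasure 𝓦 × 𝓧 => f q.1 q.2) :
    Measurable fun q : ProbabilityMeasure 𝓦 × 𝓧 × 𝓐 =>
      ∫⁻ x', f q.1 x' ∂M.trans i (q.2.1, q.2.2) :=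
  measurable_lintegral_kernel (M.trans i) (by fun_prop)
    (hf.comp (f := fun q : (ProbabilityMeasure 𝓦 × 𝓧 × 𝓐) × 𝓧 => (q.1.1, q.2)) (by fun_prop))

theorem measurable_costToGo {f : 𝓧 × 𝓨 × 𝓐 → ℝ≥0∞} (hf : Measurable f)
    (ψ : MarkovStrategy 𝓦 𝓧 𝓐) (r i : ℕ) :
    Measurable fun q : ProbabilityMeasure 𝓦 × 𝓧 => M.costToGo f ψ r i q.1 q.2 := by
  induction r generalizing i with
  | zero => exact measurable_const
  | succ r ih =>
    have hq : Measurable fun q : ProbabilityMeasure 𝓦 × 𝓧 => (q.1, q.2, ψ.est i (q.1, q.2)) :=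
      Measurable.prodMk (by fun_prop) (Measurable.prodMk (by fun_prop) (ψ.measurable_est i))
    exact ((M.measurable_meanCost hf).comp hq).add
      ((M.measurable_lintegral_trans i (ih (i + 1))).comp hq)

theorem costToGo_congr (f : 𝓧 × 𝓨 × 𝓐 → ℝ≥0∞) {ψ ψ' : MarkovStrategy 𝓦 𝓧 𝓐} (r i : ℕ)
    (h : ∀ j, i ≤ j → j < i + r → ψ.est j = ψ'.est j) :
    M.costToGo f ψ r i = M.costToGo f ψ' r i := by
  induction r generalizing i with
  | zero => rfl
  | succ r ih =>
    funext π x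
    simp only [costToGo, h i le_rfl (by omega),
      ih (i + 1) fun j hj hj' => h j (by omega) (by omega)]

theorem costToGo_tail (f : 𝓧 × 𝓨 × 𝓐 → ℝ≥0∞) (ψ : MarkovStrategy 𝓦 𝓧 𝓐) (i r k : ℕ) :
    (M.tail i).costToGo f (ψ.tail i) r k = M.costToGo f ψ r (i + k) := by
  induction r generalizing k with
  | zero => rfl
  | succ r ih =>
    funext π x
    simp only [costToGo, ih]
    rfl

/-- The integral, under the law of the process, of a function of the data, the visible history
before round `i` and the observation in round `i`. -/
noncomputable def visibleIntegral (μ : Measure (𝓦 × 𝓩)) (ν : Measure 𝓧) (φ : Strategy 𝓩 𝓧 𝓐)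
    (i : ℕ) (F : 𝓩 → (Fin i → 𝓧 × 𝓐) → 𝓧 → ℝ≥0∞) : ℝ≥0∞ :=
  ∫⁻ p, ∫⁻ x, F p.1.2 (visible p.2) x ∂M.nextObs ν i (visible p.2) ∂M.law μ ν φ i

theorem visibleIntegral_add (μ : Measure (𝓦 × 𝓩)) (ν : Measure 𝓧) [IsProbabilityMeasure ν]
    (φ : Strategy 𝓩 𝓧 𝓐) (i : ℕ)
    {F G : 𝓩 → (Fin i → 𝓧 × 𝓐) → 𝓧 → ℝ≥0∞}
    (hF : Measurable fun q : 𝓩 × (Fin i → 𝓧 × 𝓐) × 𝓧 => F q.1 q.2.1 q.2.2) :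
    M.visibleIntegral μ ν φ i (fun z r x => F z r x + G z r x)
      = M.visibleIntegral μ ν φ i F + M.visibleIntegral μ ν φ i G := by
  unfold visibleIntegral
  have hF' : Measurable fun q : ((𝓦 × 𝓩) × (Fin i → 𝓧 × 𝓨 × 𝓐)) × 𝓧 =>
      F q.1.1.2 (visible q.1.2) q.2 :=
    hF.comp (f := fun q : ((𝓦 × 𝓩) × (Fin i → 𝓧 × 𝓨 × 𝓐)) × 𝓧 =>
      (q.1.1.2, visible q.1.2, q.2)) (by fun_prop)
  rw [← lintegral_add_left (measurable_lintegral_kernel _ (by fun_prop) hF')]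
  refine lintegral_congr fun p => ?_
  rw [lintegral_add_left]
  exact hF'.comp (f := fun x => (p, x)) (by fun_prop)

variable (μ : Measure (𝓦 × 𝓩)) [IsProbabilityMeasure μ] (ν : Measure 𝓧) [IsProbabilityMeasure ν]

/-- Integration against the law of all the rounds reduces to `visibleIntegral`. -/
theorem lintegral_law_visible (φ : Strategy 𝓩 𝓧 𝓐) {i n : ℕ} (hi : i < n)
    {F : 𝓩 → (Fin i → 𝓧 × 𝓐) → 𝓧 → ℝ≥0∞}
    (hF : Measurable fun q : 𝓩 × (Fin i → 𝓧 × 𝓐) × 𝓧 => F q.1 q.2.1 q.2.2) :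
    ∫⁻ p, F p.1.2 (visible (truncate hi.le p.2)) (p.2 ⟨i, hi⟩).1 ∂M.law μ ν φ n
      = M.visibleIntegral μ ν φ i F := by
  have hF' : Measurable fun p : (𝓦 × 𝓩) × (Fin (i + 1) → 𝓧 × 𝓨 × 𝓐) =>
      F p.1.2 (visible (truncate i.le_succ p.2)) (p.2 (Fin.last i)).1 :=
    hF.comp (f := fun p : (𝓦 × 𝓩) × (Fin (i + 1) → 𝓧 × 𝓨 × 𝓐) =>
      (p.1.2, visible (truncate i.le_succ p.2), (p.2 (Fin.last i)).1)) (by fun_prop)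
  refine (M.lintegral_law_truncate μ ν φ (Nat.succ_le_of_lt hi) hF').trans ?_
  rw [lintegral_law_succ _ _ _ _ _ hF']
  simp only [truncate_snoc le_rfl, truncate_self, Fin.snoc_last, lintegral_const, measure_univ,
    mul_one]
  rfl

/-- The cost of one round may be replaced by its average over the quantity of interest and over
the posterior of the parameter. -/
theorem lintegral_law_cost {g : 𝓩 → ProbabilityMeasure 𝓦} (hg : Measurable g)
    (hμ : IsPosterior μ g) (φ : Strategy 𝓩 𝓧 𝓐) {i n : ℕ} (hi : i < n)
    {B : 𝓩 → (Fin i → 𝓧 × 𝓐) → 𝓧 → ℝ≥0∞}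
    (hB : Measurable fun q : 𝓩 × (Fin i → 𝓧 × 𝓐) × 𝓧 => B q.1 q.2.1 q.2.2)
    {f : 𝓧 × 𝓨 × 𝓐 → ℝ≥0∞} (hf : Measurable f) :
    ∫⁻ p, B p.1.2 (visible (truncate hi.le p.2)) (p.2 ⟨i, hi⟩).1 * f (p.2 ⟨i, hi⟩)
        ∂M.law μ ν φ n
      = M.visibleIntegral μ ν φ i
          fun z r x => B z r x * M.meanCost f (g z) x (φ.act z r x) := by
  have hB' : Measurable fun p : (𝓦 × 𝓩) × (Fin (i + 1) → 𝓧 × 𝓨 × 𝓐) =>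
      B p.1.2 (visible (truncate i.le_succ p.2)) (p.2 (Fin.last i)).1 * f (p.2 (Fin.last i)) :=
    (hB.comp (f := fun p : (𝓦 × 𝓩) × (Fin (i + 1) → 𝓧 × 𝓨 × 𝓐) =>
      (p.1.2, visible (truncate i.le_succ p.2), (p.2 (Fin.last i)).1)) (by fun_prop)).mul
      (by fun_prop)
  refine (M.lintegral_law_truncate μ ν φ (Nat.succ_le_of_lt hi) hB').trans ?_
  rw [lintegral_law_succ _ _ _ _ _ hB']
  simp only [truncate_snoc le_rfl, truncate_self, Fin.snoc_last]
  -- averaging over the quantity of interest leaves a function of the parameter, the data, the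
  -- visible history and the observation, so that the parameter can be resampled
  have hact : Measurable fun q : (𝓦 × 𝓩 × (Fin i → 𝓧 × 𝓐)) × 𝓧 =>
      φ.act q.1.2.1 q.1.2.2 q.2 :=
    φ.measurable_act (by fun_prop) (by fun_prop) (by fun_prop)
  have hH : Measurable fun q : (𝓦 × 𝓩 × (Fin i → 𝓧 × 𝓐)) × 𝓧 =>
      B q.1.2.1 q.1.2.2 q.2 * ∫⁻ y, f (q.2, y, φ.act q.1.2.1 q.1.2.2 q.2) ∂M.qty (q.2, q.1.1) := by
    refine (hB.comp (f := fun q : (𝓦 × 𝓩 × (Fin i → 𝓧 × 𝓐)) × 𝓧 =>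
      (q.1.2.1, q.1.2.2, q.2)) (by fun_prop)).mul ?_
    refine measurable_lintegral_kernel M.qty (by fun_prop) (hf.comp ?_)
    exact Measurable.prodMk (by fun_prop) (Measurable.prodMk (by fun_prop)
      (hact.comp measurable_fst))
  have hmul : ∀ (p : (𝓦 × 𝓩) × (Fin i → 𝓧 × 𝓨 × 𝓐)) (x : 𝓧),
      ∫⁻ y, B p.1.2 (visible p.2) x * f (x, y, φ.act p.1.2 (visible p.2) x) ∂M.qty (x, p.1.1)
        = B p.1.2 (visible p.2) x *
          ∫⁻ y, f (x, y, φ.act p.1.2 (visible p.2) x) ∂M.qty (x, p.1.1) := fun p x =>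
    lintegral_const_mul _ (by fun_prop)
  simp only [hmul]
  rw [M.lintegral_law_resample ν hg hμ φ i (G := fun q => ∫⁻ x, B q.2.1 q.2.2 x *
    (∫⁻ y, f (x, y, φ.act q.2.1 q.2.2 x) ∂M.qty (x, q.1)) ∂M.nextObs ν i q.2.2)
    (measurable_lintegral_kernel (M.nextObs ν i) (by fun_prop) hH)]
  unfold visibleIntegral
  refine lintegral_congr fun p => ?_
  dsimp only
  rw [lintegral_lintegral_swap]
  · refine lintegral_congr fun x => ?_
    rw [meanCost, lintegral_const_mul]
    refine measurable_lintegral_kernel M.qty (by fun_prop) (by fun_prop)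
  · refine Measurable.aemeasurable ?_
    exact hH.comp (f := fun q : 𝓦 × 𝓧 => ((q.1, p.1.2, visible p.2), q.2)) (by fun_prop)

/-- One step of the evolution of the observations. -/
theorem visibleIntegral_succ (φ : Strategy 𝓩 𝓧 𝓐) (i : ℕ)
    {F : 𝓩 → (Fin (i + 1) → 𝓧 × 𝓐) → 𝓧 → ℝ≥0∞}
    (hF : Measurable fun q : 𝓩 × (Fin (i + 1) → 𝓧 × 𝓐) × 𝓧 => F q.1 q.2.1 q.2.2) :
    M.visibleIntegral μ ν φ (i + 1) F
      = M.visibleIntegral μ ν φ i fun z r x => ∫⁻ x',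
          F z (Fin.snoc (α := fun _ => 𝓧 × 𝓐) r (x, φ.act z r x)) x'
            ∂M.trans i (x, φ.act z r x) := by
  unfold visibleIntegral
  rw [lintegral_law_succ]
  · simp only [visible_snoc, nextObs_succ_snoc, lintegral_const, measure_univ, mul_one]
  · refine measurable_lintegral_kernel _ (by fun_prop) ?_
    exact hF.comp (f := fun q : ((𝓦 × 𝓩) × (Fin (i + 1) → 𝓧 × 𝓨 × 𝓐)) × 𝓧 =>
      (q.1.1.2, visible q.1.2, q.2)) (by fun_prop)

/-- If a strategy is Markov from round `i` on, then `costToGo` is the conditional expectation of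
the cost accumulated from round `i` on, given the data and all that is visible in round `i`. -/
theorem lintegral_law_costToGo {g : 𝓩 → ProbabilityMeasure 𝓦} (hg : Measurable g)
    (hμ : IsPosterior μ g) (φ : Strategy 𝓩 𝓧 𝓐) (ψ : MarkovStrategy 𝓦 𝓧 𝓐)
    {f : 𝓧 × 𝓨 × 𝓐 → ℝ≥0∞} (hf : Measurable f) {n : ℕ} (r i : ℕ) (hir : i + (r + 1) = n)
    (hi : i < n) (hφ : ∀ j, i ≤ j → ∀ z (h : Fin j → 𝓧 × 𝓐) x, φ.act z h x = ψ.est j (g z, x))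
    {B : 𝓩 → (Fin i → 𝓧 × 𝓐) → 𝓧 → ℝ≥0∞}
    (hB : Measurable fun q : 𝓩 × (Fin i → 𝓧 × 𝓐) × 𝓧 => B q.1 q.2.1 q.2.2) :
    ∫⁻ p, B p.1.2 (visible (truncate hi.le p.2)) (p.2 ⟨i, hi⟩).1 *
        ∑ j ∈ Finset.Ici (⟨i, hi⟩ : Fin n), f (p.2 j) ∂M.law μ ν φ n
      = M.visibleIntegral μ ν φ i fun z h x => B z h x * M.costToGo f ψ (r + 1) i (g z) x := by
  induction r generalizing i with
  | zero =>
    have hs : Finset.Ici (⟨i, hi⟩ : Fin n) = {⟨i, hi⟩} := by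
      ext j
      simp only [Finset.mem_Ici, Finset.mem_singleton, Fin.le_def, Fin.ext_iff]
      omega
    simp only [hs, Finset.sum_singleton, costToGo, lintegral_zero, add_zero]
    rw [M.lintegral_law_cost μ ν hg hμ φ hi hB hf]
    simp only [hφ i le_rfl]
  | succ r ih =>
    have hi' : i + 1 < n := by omega
    have hs : Finset.Ici (⟨i, hi⟩ : Fin n)
        = insert ⟨i, hi⟩ (Finset.Ici (⟨i + 1, hi'⟩ : Fin n)) := by
      ext j
      simp only [Finset.mem_Ici, Finset.mem_insert, Fin.le_def, Fin.ext_iff]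
      omega
    have hnot : (⟨i, hi⟩ : Fin n) ∉ Finset.Ici (⟨i + 1, hi'⟩ : Fin n) := by
      simp [Fin.le_def]
    have hB₁ : Measurable fun p : (𝓦 × 𝓩) × (Fin n → 𝓧 × 𝓨 × 𝓐) =>
        B p.1.2 (visible (truncate hi.le p.2)) (p.2 ⟨i, hi⟩).1 :=
      hB.comp (f := fun p : (𝓦 × 𝓩) × (Fin n → 𝓧 × 𝓨 × 𝓐) =>
        (p.1.2, visible (truncate hi.le p.2), (p.2 ⟨i, hi⟩).1)) (by fun_prop)
    have hB₂ : Measurable fun q : 𝓩 × (Fin (i + 1) → 𝓧 × 𝓐) × 𝓧 =>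
        B q.1 (truncate i.le_succ q.2.1) (q.2.1 (Fin.last i)).1 :=
      hB.comp (f := fun q : 𝓩 × (Fin (i + 1) → 𝓧 × 𝓐) × 𝓧 =>
        (q.1, truncate i.le_succ q.2.1, (q.2.1 (Fin.last i)).1)) (by fun_prop)
    have hC := M.measurable_costToGo hf ψ (r + 1) (i + 1)
    have hrest : ∫⁻ p, B p.1.2 (visible (truncate hi.le p.2)) (p.2 ⟨i, hi⟩).1 *
          ∑ j ∈ Finset.Ici (⟨i + 1, hi'⟩ : Fin n), f (p.2 j) ∂M.law μ ν φ n
        = M.visibleIntegral μ ν φ i fun z h x => B z h x *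
            ∫⁻ x', M.costToGo f ψ (r + 1) (i + 1) (g z) x'
              ∂M.trans i (x, ψ.est i (g z, x)) := by
      have := ih (i + 1) (by omega) hi' (fun j hj => hφ j (by omega))
        (B := fun z h _ => B z (truncate i.le_succ h) (h (Fin.last i)).1) hB₂
      refine this.trans ?_
      rw [visibleIntegral_succ]
      · simp only [truncate_snoc le_rfl, truncate_self, Fin.snoc_last, hφ i le_rfl]
        congr 1
        funext z h x
        rw [lintegral_const_mul]
        exact hC.comp (f := fun x' => (g z, x')) (by fun_prop)
      · exact hB₂.mul (hC.comp (f := fun q : 𝓩 × (Fin (i + 1) → 𝓧 × 𝓐) × 𝓧 => (g q.1, q.2.2))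
          (by fun_prop))
    have hest : Measurable fun q : 𝓩 × (Fin i → 𝓧 × 𝓐) × 𝓧 =>
        (g q.1, q.2.2, ψ.est i (g q.1, q.2.2)) :=
      Measurable.prodMk (by fun_prop) (Measurable.prodMk (by fun_prop)
        ((ψ.measurable_est i).comp (f := fun q : 𝓩 × (Fin i → 𝓧 × 𝓐) × 𝓧 => (g q.1, q.2.2))
          (by fun_prop)))
    simp only [hs, Finset.sum_insert hnot, mul_add]
    rw [lintegral_add_left (f := fun p : (𝓦 × 𝓩) × (Fin n → 𝓧 × 𝓨 × 𝓐) =>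
      B p.1.2 (visible (truncate hi.le p.2)) (p.2 ⟨i, hi⟩).1 * f (p.2 ⟨i, hi⟩))
      (hB₁.mul (by fun_prop)), hrest,
      M.lintegral_law_cost μ ν hg hμ φ hi hB hf, ← visibleIntegral_add]
    · simp only [hφ i le_rfl, ← mul_add]
      rfl
    · simp only [hφ i le_rfl]
      exact hB.mul ((M.measurable_meanCost hf).comp hest)

end Model

end DynInf

namespace DynInf

namespace Model

variable {𝓦 𝓩 𝓧 𝓨 𝓐 : Type*} [MeasurableSpace 𝓦] [MeasurableSpace 𝓩] [MeasurableSpace 𝓧]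
  [MeasurableSpace 𝓨] [MeasurableSpace 𝓐]

/-! ### Posteriors and losses -/

theorem isPosterior_post [StandardBorelSpace 𝓦] [Nonempty 𝓦] (PW : Measure 𝓦)
    [IsProbabilityMeasure PW] (PZ : Kernel 𝓦 𝓩) [IsMarkovKernel PZ] :
    IsPosterior (PW ⊗ₘ PZ) (post PW PZ) := by
  intro G hG
  have h : ∀ F : 𝓦 × 𝓩 → ℝ≥0∞, Measurable F → ∫⁻ a, F a ∂(PW ⊗ₘ PZ)
      = ∫⁻ z, ∫⁻ w, F (w, z) ∂posterior PZ PW z ∂(PZ ∘ₘ PW) := fun F hF => by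
    have hF' : Measurable fun a : 𝓩 × 𝓦 => F (a.2, a.1) := by fun_prop
    rw [← Measure.lintegral_compProd hF', compProd_posterior_eq_map_swap,
      lintegral_map hF' measurable_swap]
    rfl
  rw [h G hG, h (fun a => ∫⁻ w, G (w, a.2) ∂(post PW PZ a.2 : Measure 𝓦))]
  · simp only [lintegral_const, measure_univ, mul_one]
    rfl
  · exact measurable_lintegral_probabilityMeasure
      ((measurable_post PW PZ).comp measurable_snd) (by fun_prop)

theorem isPosterior_beliefLaw (π : ProbabilityMeasure 𝓦) :
    IsPosterior (beliefLaw π) (fun _ : Unit => π) := by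
  intro G hG
  unfold beliefLaw
  rw [lintegral_prod _ hG.aemeasurable, lintegral_prod]
  · simp
  · exact (measurable_lintegral_probabilityMeasure measurable_const
      (hG.comp (f := fun p : (𝓦 × Unit) × 𝓦 => (p.2, p.1.2)) (by fun_prop))).aemeasurable

instance (π : ProbabilityMeasure 𝓦) : IsProbabilityMeasure (beliefLaw π) := by
  unfold beliefLaw; infer_instance

theorem toStrategy_act (ψ : MarkovStrategy 𝓦 𝓧 𝓐) (g : 𝓩 → ProbabilityMeasure 𝓦)
    (hg : Measurable g) {k : ℕ} (z : 𝓩) (h : Fin k → 𝓧 × 𝓐) (x : 𝓧) :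
    (ψ.toStrategy g hg).act z h x = ψ.est k (g z, x) := by
  simp [Strategy.act, MarkovStrategy.toStrategy]

variable (M : Model 𝓦 𝓧 𝓨 𝓐)

/-- The positive part of the loss in one round. -/
noncomputable def lossPos (t : 𝓧 × 𝓨 × 𝓐) : ℝ≥0∞ := ENNReal.ofReal (M.roundLoss t)

/-- The negative part of the loss in one round. -/
noncomputable def lossNeg (t : 𝓧 × 𝓨 × 𝓐) : ℝ≥0∞ := ENNReal.ofReal (-M.roundLoss t)

@[fun_prop]
theorem measurable_roundLoss : Measurable M.roundLoss := M.measurable_loss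

@[fun_prop]
theorem measurable_lossPos : Measurable M.lossPos := by unfold lossPos; fun_prop

@[fun_prop]
theorem measurable_lossNeg : Measurable M.lossNeg := by unfold lossNeg; fun_prop

/-! ### The loss-to-go -/

/-- Under a Markov strategy, the cost-to-go is the conditional expectation of the cost accumulated
from round `i` on, given the posterior and the observation in round `i`. -/
theorem setLIntegral_law_costToGo (μ : Measure (𝓦 × 𝓩)) [IsProbabilityMeasure μ] (ν : Measure 𝓧)
    [IsProbabilityMeasure ν] {g : 𝓩 → ProbabilityMeasure 𝓦} (hg : Measurable g)
    (hμ : IsPosterior μ g) (ψ : MarkovStrategy 𝓦 𝓧 𝓐) {f : 𝓧 × 𝓨 × 𝓐 → ℝ≥0∞} (hf : Measurable f)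
    {n : ℕ} (i : Fin n) {S : Set (ProbabilityMeasure 𝓦 × 𝓧)} (hS : MeasurableSet S) :
    ∫⁻ ω in {ω | (g ω.1.2, (ω.2 i).1) ∈ S}, ∑ j ∈ Finset.Ici i, f (ω.2 j)
        ∂M.law μ ν (ψ.toStrategy g hg) n
      = ∫⁻ ω in {ω | (g ω.1.2, (ω.2 i).1) ∈ S}, M.costToGo f ψ (n - i) i (g ω.1.2) (ω.2 i).1
        ∂M.law μ ν (ψ.toStrategy g hg) n := by
  have hS' : MeasurableSet {ω : (𝓦 × 𝓩) × (Fin n → 𝓧 × 𝓨 × 𝓐) | (g ω.1.2, (ω.2 i).1) ∈ S} :=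
    hS.preimage (f := fun ω : (𝓦 × 𝓩) × (Fin n → 𝓧 × 𝓨 × 𝓐) => (g ω.1.2, (ω.2 i).1))
      (by fun_prop)
  have hind : ∀ F : (𝓦 × 𝓩) × (Fin n → 𝓧 × 𝓨 × 𝓐) → ℝ≥0∞,
      ∫⁻ ω in {ω | (g ω.1.2, (ω.2 i).1) ∈ S}, F ω ∂M.law μ ν (ψ.toStrategy g hg) n
        = ∫⁻ ω, S.indicator 1 (g ω.1.2, (ω.2 i).1) * F ω
            ∂M.law μ ν (ψ.toStrategy g hg) n := fun F => by
    rw [← lintegral_indicator hS']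
    refine lintegral_congr fun ω => ?_
    by_cases h : (g ω.1.2, (ω.2 i).1) ∈ S <;> simp [h, Set.indicator]
  have hB : Measurable fun q : 𝓩 × (Fin (i : ℕ) → 𝓧 × 𝓐) × 𝓧 =>
      S.indicator (1 : ProbabilityMeasure 𝓦 × 𝓧 → ℝ≥0∞) (g q.1, q.2.2) :=
    (measurable_one.indicator hS).comp
      (f := fun q : 𝓩 × (Fin (i : ℕ) → 𝓧 × 𝓐) × 𝓧 => (g q.1, q.2.2)) (by fun_prop)
  obtain ⟨r, hr⟩ : ∃ r, n - (i : ℕ) = r + 1 := ⟨n - i - 1, by omega⟩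
  rw [hind, hind, hr]
  refine (M.lintegral_law_costToGo μ ν hg hμ _ ψ hf r i (by omega) i.2
    (fun j _ z h x => toStrategy_act ψ g hg z h x)
    (B := fun z _ x => S.indicator 1 (g z, x)) hB).trans
    (M.lintegral_law_visible μ ν (ψ.toStrategy g hg) i.2
      (F := fun z _ x => S.indicator 1 (g z, x) * M.costToGo f ψ (r + 1) i (g z) x) ?_).symm
  refine hB.mul ?_
  exact (M.measurable_costToGo hf ψ (r + 1) i).comp
    (f := fun q : 𝓩 × (Fin (i : ℕ) → 𝓧 × 𝓐) × 𝓧 => (g q.1, q.2.2)) (by fun_prop)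

/-- The tail of the process started from the posterior `π` and the observation `x` has accumulated
cost `costToGo`; here the datum is trivial and `π` is its own posterior. -/
theorem lintegral_law_tailStrategy (ψ : MarkovStrategy 𝓦 𝓧 𝓐) {f : 𝓧 × 𝓨 × 𝓐 → ℝ≥0∞}
    (hf : Measurable f) {n i : ℕ} (hi : i < n) (π : ProbabilityMeasure 𝓦) (x : 𝓧) :
    ∫⁻ ω, ∑ j, f (ω.2 j)
        ∂(M.tail i).law (beliefLaw π) (Measure.dirac x) (tailStrategy ψ i π) (n - i)
      = M.costToGo f ψ (n - i) i π x := by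
  obtain ⟨r, hr⟩ : ∃ r, n - i = r + 1 := ⟨n - i - 1, by omega⟩
  rw [hr]
  have h := (M.tail i).lintegral_law_costToGo (beliefLaw π) (Measure.dirac x) measurable_const
    (isPosterior_beliefLaw π) (tailStrategy ψ i π) (ψ.tail i) hf r 0 (zero_add _) (by omega)
    (fun j _ z h x => toStrategy_act _ _ measurable_const z h x) (B := fun _ _ _ => 1)
    measurable_const
  have hs : Finset.Ici (⟨0, by omega⟩ : Fin (r + 1)) = Finset.univ := by
    ext j; simp
  simp only [one_mul, hs] at h
  rw [h, visibleIntegral]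
  simp only [costToGo_tail, nextObs, Kernel.const_apply, add_zero]
  have hm : Measurable fun x' => M.costToGo f ψ (r + 1) i π x' :=
    (M.measurable_costToGo hf ψ (r + 1) i).comp (f := fun x' => (π, x')) (by fun_prop)
  simp only [lintegral_dirac' _ hm, lintegral_const, measure_univ, mul_one]

theorem costToGo_lossNeg_ne_top (ψ : MarkovStrategy 𝓦 𝓧 𝓐) {n i : ℕ} (hi : i < n)
    (π : ProbabilityMeasure 𝓦) (x : 𝓧)
    (h : (M.tail i).NegPartIntegrable (n - i) (beliefLaw π) (Measure.dirac x)
      (tailStrategy ψ i π)) :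
    M.costToGo M.lossNeg ψ (n - i) i π x ≠ ∞ := by
  rw [← M.lintegral_law_tailStrategy ψ M.measurable_lossNeg hi,
    lintegral_finsetSum _ (by fun_prop)]
  exact ENNReal.sum_ne_top.2 fun j _ => h j

/-- The loss-to-go is a difference of two costs-to-go that are measurable in the posterior and the
observation. -/
theorem lossToGo_eq (ψ : MarkovStrategy 𝓦 𝓧 𝓐) {n i : ℕ} (hi : i < n)
    (π : ProbabilityMeasure 𝓦) (x : 𝓧)
    (h : (M.tail i).NegPartIntegrable (n - i) (beliefLaw π) (Measure.dirac x)
      (tailStrategy ψ i π)) :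
    M.lossToGo n ψ i π x = (M.costToGo M.lossPos ψ (n - i) i π x : EReal)
      - M.costToGo M.lossNeg ψ (n - i) i π x := by
  rw [← M.lintegral_law_tailStrategy ψ M.measurable_lossNeg hi,
    ← M.lintegral_law_tailStrategy ψ M.measurable_lossPos hi]
  have h' : (M.tail i).roundLoss = M.roundLoss := rfl
  unfold NegPartIntegrable at h
  unfold lossToGo inferenceLoss lossPos lossNeg
  rw [h'] at h ⊢
  exact expect_coe_sum Finset.univ
    (f := fun j (ω : (𝓦 × Unit) × (Fin (n - i) → 𝓧 × 𝓨 × 𝓐)) => M.roundLoss (ω.2 j))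
    (fun j => by fun_prop) h

theorem avgLoss_eq {π : ProbabilityMeasure 𝓦} {x : 𝓧} {a : 𝓐}
    (h : M.meanCost M.lossNeg π x a ≠ ∞) :
    M.avgLoss π x a = (M.meanCost M.lossPos π x a : EReal) - M.meanCost M.lossNeg π x a := by
  -- the inner expectation is such a difference by definition, whether or not the parts are finite
  have hy : ∀ w, expect (M.qty (x, w)) (fun y => ((M.loss x y a : ℝ) : EReal))
      = ((∫⁻ y, M.lossPos (x, y, a) ∂M.qty (x, w) : ℝ≥0∞) : EReal)
        - ((∫⁻ y, M.lossNeg (x, y, a) ∂M.qty (x, w) : ℝ≥0∞) : EReal) := fun w => by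
    simp only [expect, ← EReal.coe_neg, EReal.real_coe_toENNReal]
    rfl
  have hm : ∀ {f : 𝓧 × 𝓨 × 𝓐 → ℝ≥0∞}, Measurable f →
      Measurable fun w => ∫⁻ y, f (x, y, a) ∂M.qty (x, w) := fun hf =>
    measurable_lintegral_kernel M.qty (φ := fun w => (x, w)) (by fun_prop)
      (hf.comp (f := fun p : 𝓦 × 𝓨 => (x, p.2, a)) (by fun_prop))
  simp only [avgLoss, hy]
  rw [expect_coe_sub_coe (hm M.measurable_lossPos) (hm M.measurable_lossNeg) h]
  rfl

/-! ### Dynamic programming -/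

section DynamicProgramming

variable {n : ℕ} (hneg : ∀ (ψ : MarkovStrategy 𝓦 𝓧 𝓐) (i : Fin n) (π : ProbabilityMeasure 𝓦)
  (x : 𝓧), (M.tail i).NegPartIntegrable (n - i) (beliefLaw π) (Measure.dirac x)
    (tailStrategy ψ i π))

include hneg

/-- The backward recursion for the loss-to-go of a Markov strategy. -/
theorem lossToGo_eq_add (ψ : MarkovStrategy 𝓦 𝓧 𝓐) {i : ℕ} (hi : i < n)
    (π : ProbabilityMeasure 𝓦) (x : 𝓧) :
    M.lossToGo n ψ i π x = if i + 1 < n then M.avgLoss π x (ψ.est i (π, x)) +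
        expect (M.trans i (x, ψ.est i (π, x))) (fun x' => M.lossToGo n ψ (i + 1) π x')
      else M.avgLoss π x (ψ.est i (π, x)) := by
  have hfin := M.costToGo_lossNeg_ne_top ψ hi π x (hneg ψ ⟨i, hi⟩ π x)
  rw [M.lossToGo_eq ψ hi π x (hneg ψ ⟨i, hi⟩ π x)]
  obtain ⟨r, hr⟩ : ∃ r, n - i = r + 1 := ⟨n - i - 1, by omega⟩
  rw [hr] at hfin ⊢
  simp only [costToGo] at hfin ⊢
  obtain ⟨h₁, h₂⟩ := ENNReal.add_ne_top.1 hfin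
  rw [coe_add_sub_coe_add h₁ h₂, ← M.avgLoss_eq h₁]
  split_ifs with hlt
  · have hr' : r = n - (i + 1) := by omega
    subst hr'
    have hm : ∀ {f : 𝓧 × 𝓨 × 𝓐 → ℝ≥0∞}, Measurable f →
        Measurable fun x' => M.costToGo f ψ (n - (i + 1)) (i + 1) π x' := fun hf =>
      (M.measurable_costToGo hf ψ (n - (i + 1)) (i + 1)).comp (f := fun x' => (π, x'))
        (by fun_prop)
    rw [← expect_coe_sub_coe (hm M.measurable_lossPos) (hm M.measurable_lossNeg) h₂]
    simp only [M.lossToGo_eq ψ hlt π _ (hneg ψ ⟨i + 1, hlt⟩ π _)]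
  · have hr' : r = 0 := by omega
    subst hr'
    simp [costToGo]

/-- The dynamic programming value bounds the loss-to-go of every Markov strategy from below. -/
theorem Vstar_le_lossToGo (ψ : MarkovStrategy 𝓦 𝓧 𝓐) (r i : ℕ) (hir : i + (r + 1) = n)
    (π : ProbabilityMeasure 𝓦) (x : 𝓧) : M.Vstar n i π x ≤ M.lossToGo n ψ i π x := by
  induction r generalizing i x with
  | zero =>
    refine (iInf_le _ (ψ.est i (π, x))).trans ?_
    rw [Qstar, M.lossToGo_eq_add hneg ψ (by omega), if_neg (by omega), if_neg (by omega)]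
  | succ r ih =>
    refine (iInf_le _ (ψ.est i (π, x))).trans ?_
    rw [Qstar, M.lossToGo_eq_add hneg ψ (by omega), if_pos (by omega), if_pos (by omega)]
    exact add_le_add le_rfl (expect_mono fun x' => ih (i + 1) (by omega) x')

variable {ψs : MarkovStrategy 𝓦 𝓧 𝓐} (hψs : ∀ (i : Fin n) (π : ProbabilityMeasure 𝓦) (x : 𝓧),
  IsMinOn (M.Qstar n i π x) Set.univ (ψs.est i (π, x)))

include hψs

/-- The dynamic programming value is the loss-to-go of a Markov strategy that makes minimizing
estimates from round `i` on. -/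
theorem lossToGo_eq_Vstar (ψ : MarkovStrategy 𝓦 𝓧 𝓐) (r i : ℕ) (hir : i + (r + 1) = n)
    (hψ : ∀ j, i ≤ j → j < n → ∀ (π : ProbabilityMeasure 𝓦) (x : 𝓧),
      ψ.est j (π, x) = ψs.est j (π, x)) (π : ProbabilityMeasure 𝓦) (x : 𝓧) :
    M.lossToGo n ψ i π x = M.Vstar n i π x := by
  -- the infimum in `Vstar` is attained at `ψs`
  have hmin : ∀ {i : ℕ}, i < n → ∀ x, M.Vstar n i π x = M.Qstar n i π x (ψs.est i (π, x)) :=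
    fun {i} hi x => le_antisymm (iInf_le _ _)
      (le_iInf fun a => hψs ⟨i, hi⟩ π x (Set.mem_univ a))
  induction r generalizing i x with
  | zero =>
    rw [hmin (by omega), Qstar, M.lossToGo_eq_add hneg ψ (by omega), if_neg (by omega),
      if_neg (by omega), hψ i le_rfl (by omega)]
  | succ r ih =>
    rw [hmin (by omega), Qstar, M.lossToGo_eq_add hneg ψ (by omega), if_pos (by omega),
      if_pos (by omega), hψ i le_rfl (by omega)]
    simp only [ih (i + 1) (by omega) fun j hj => hψ j (by omega)]
    rfl

end DynamicProgramming

/-- The Markov strategy that makes the estimate `a` in round `i` and follows `ψ` in the other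
rounds. -/
noncomputable def _root_.DynInf.MarkovStrategy.modify (ψ : MarkovStrategy 𝓦 𝓧 𝓐) (i : ℕ) (a : 𝓐) :
    MarkovStrategy 𝓦 𝓧 𝓐 where
  est := Function.update ψ.est i fun _ => a
  measurable_est j := by
    rcases eq_or_ne j i with rfl | h
    · simp
    · simpa [h] using ψ.measurable_est j

/-- The expected cost `f` of the rounds from round `i` on when the estimate in round `i` is `a` and
the Markov strategy `ψ` is used in the following `r` rounds. -/
noncomputable def actionCost (f : 𝓧 × 𝓨 × 𝓐 → ℝ≥0∞) (ψ : MarkovStrategy 𝓦 𝓧 𝓐) (r i : ℕ)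
    (π : ProbabilityMeasure 𝓦) (x : 𝓧) (a : 𝓐) : ℝ≥0∞ :=
  M.meanCost f π x a + ∫⁻ x', M.costToGo f ψ r (i + 1) π x' ∂M.trans i (x, a)

theorem measurable_actionCost {f : 𝓧 × 𝓨 × 𝓐 → ℝ≥0∞} (hf : Measurable f)
    (ψ : MarkovStrategy 𝓦 𝓧 𝓐) (r i : ℕ) :
    Measurable fun q : ProbabilityMeasure 𝓦 × 𝓧 × 𝓐 => M.actionCost f ψ r i q.1 q.2.1 q.2.2 :=
  (M.measurable_meanCost hf).add
    (M.measurable_lintegral_trans i (M.measurable_costToGo hf ψ r (i + 1)))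

theorem costToGo_modify (f : 𝓧 × 𝓨 × 𝓐 → ℝ≥0∞) (ψ : MarkovStrategy 𝓦 𝓧 𝓐) (r i : ℕ)
    (π : ProbabilityMeasure 𝓦) (x : 𝓧) (a : 𝓐) :
    M.costToGo f (ψ.modify i a) (r + 1) i π x = M.actionCost f ψ r i π x a := by
  have h₁ : (ψ.modify i a).est i (π, x) = a := by simp [MarkovStrategy.modify]
  have h₂ : M.costToGo f (ψ.modify i a) r (i + 1) = M.costToGo f ψ r (i + 1) :=
    M.costToGo_congr f r (i + 1) fun j hj _ => by
      simp [MarkovStrategy.modify, show j ≠ i by omega]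
  rw [costToGo, h₁, h₂, actionCost]

/-- In terms of costs: an arbitrary estimate in round `i`, followed by the strategy of dynamic
programming, is no better than that strategy. -/
theorem costToGo_sub_le_actionCost_sub {n : ℕ}
    (hneg : ∀ (ψ : MarkovStrategy 𝓦 𝓧 𝓐) (i : Fin n) (π : ProbabilityMeasure 𝓦)
      (x : 𝓧), (M.tail i).NegPartIntegrable (n - i) (beliefLaw π) (Measure.dirac x)
        (tailStrategy ψ i π))
    {ψs : MarkovStrategy 𝓦 𝓧 𝓐} (hψs : ∀ (i : Fin n) (π : ProbabilityMeasure 𝓦) (x : 𝓧),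
      IsMinOn (M.Qstar n i π x) Set.univ (ψs.est i (π, x)))
    (r i : ℕ) (hir : i + (r + 1) = n) (π : ProbabilityMeasure 𝓦) (x : 𝓧) (a : 𝓐) :
    (M.costToGo M.lossPos ψs (r + 1) i π x : EReal) - M.costToGo M.lossNeg ψs (r + 1) i π x
      ≤ (M.actionCost M.lossPos ψs r i π x a : EReal) - M.actionCost M.lossNeg ψs r i π x a := by
  have h₁ := M.lossToGo_eq ψs (show i < n by omega) π x (hneg _ ⟨i, by omega⟩ π x)
  have h₂ := M.lossToGo_eq (ψs.modify i a) (show i < n by omega) π x (hneg _ ⟨i, by omega⟩ π x)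
  rw [show n - i = r + 1 by omega] at h₁ h₂
  rw [costToGo_modify, costToGo_modify] at h₂
  rw [← h₁, ← h₂, M.lossToGo_eq_Vstar hneg hψs ψs r i hir fun _ _ _ _ _ => rfl]
  exact M.Vstar_le_lossToGo hneg _ r i hir π x

end Model

end DynInf

/-! ### Optimality among all strategies -/

namespace DynInf

variable {𝓦 𝓩 𝓧 𝓨 𝓐 : Type*} [MeasurableSpace 𝓦] [MeasurableSpace 𝓩] [MeasurableSpace 𝓧]
  [MeasurableSpace 𝓨] [MeasurableSpace 𝓐]

/-- The strategy that uses `φ` before round `i` and `φ'` from round `i` on. -/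
noncomputable def Strategy.switch (φ φ' : Strategy 𝓩 𝓧 𝓐) (i : ℕ) : Strategy 𝓩 𝓧 𝓐 where
  est j := if j < i then φ.est j else φ'.est j
  measurable_est j := by
    split_ifs
    · exact φ.measurable_est j
    · exact φ'.measurable_est j

namespace Model

variable (M : Model 𝓦 𝓧 𝓨 𝓐) (μ : Measure (𝓦 × 𝓩)) (ν : Measure 𝓧)

/-- The expected cost `f` over `n` rounds when the strategy `φ` is used before round `i` and the
Markov strategy `ψ` from round `i` on; `g` gives the posterior. -/
noncomputable def switchCost (g : 𝓩 → ProbabilityMeasure 𝓦)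
    (φ : Strategy 𝓩 𝓧 𝓐) (ψ : MarkovStrategy 𝓦 𝓧 𝓐) (f : 𝓧 × 𝓨 × 𝓐 → ℝ≥0∞) (n i : ℕ) : ℝ≥0∞ :=
  ∫⁻ ω, ∑ j ∈ Finset.univ.filter (fun j : Fin n => (j : ℕ) < i), f (ω.2 j) ∂M.law μ ν φ n
    + M.visibleIntegral μ ν φ i fun z _ x => M.costToGo f ψ (n - i) i (g z) x

theorem inferenceLoss_eq {φ : Strategy 𝓩 𝓧 𝓐} {n : ℕ} (h : M.NegPartIntegrable n μ ν φ) :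
    M.inferenceLoss n μ ν φ = ((∫⁻ ω, ∑ j, M.lossPos (ω.2 j) ∂M.law μ ν φ n : ℝ≥0∞) : EReal)
      - ((∫⁻ ω, ∑ j, M.lossNeg (ω.2 j) ∂M.law μ ν φ n : ℝ≥0∞) : EReal) :=
  expect_coe_sum Finset.univ
    (f := fun j (ω : (𝓦 × 𝓩) × (Fin n → 𝓧 × 𝓨 × 𝓐)) => M.roundLoss (ω.2 j))
    (fun j => by fun_prop) h

theorem lintegral_sum_lossNeg_ne_top {n : ℕ} {φ : Strategy 𝓩 𝓧 𝓐}
    (hneg : M.NegPartIntegrable n μ ν φ) (s : Finset (Fin n)) :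
    ∫⁻ ω, ∑ j ∈ s, M.lossNeg (ω.2 j) ∂M.law μ ν φ n ≠ ∞ := by
  rw [lintegral_finsetSum _ (by fun_prop)]
  exact ENNReal.sum_ne_top.2 fun j _ => hneg j

theorem switchCost_self (g : 𝓩 → ProbabilityMeasure 𝓦) (φ : Strategy 𝓩 𝓧 𝓐)
    (ψ : MarkovStrategy 𝓦 𝓧 𝓐) (f : 𝓧 × 𝓨 × 𝓐 → ℝ≥0∞) (n : ℕ) :
    M.switchCost μ ν g φ ψ f n n = ∫⁻ ω, ∑ j, f (ω.2 j) ∂M.law μ ν φ n := by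
  simp [switchCost, costToGo, visibleIntegral]

variable [IsProbabilityMeasure μ] [IsProbabilityMeasure ν]

theorem switchCost_zero {g : 𝓩 → ProbabilityMeasure 𝓦} (hg : Measurable g)
    (hμ : IsPosterior μ g) (φ : Strategy 𝓩 𝓧 𝓐) (ψ : MarkovStrategy 𝓦 𝓧 𝓐)
    {f : 𝓧 × 𝓨 × 𝓐 → ℝ≥0∞} (hf : Measurable f) (n : ℕ) :
    M.switchCost μ ν g φ ψ f n 0
      = ∫⁻ ω, ∑ j, f (ω.2 j) ∂M.law μ ν (ψ.toStrategy g hg) n := by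
  rcases n with _ | r
  · simp [switchCost, costToGo, visibleIntegral]
  · have h := M.lintegral_law_costToGo μ ν hg hμ (ψ.toStrategy g hg) ψ hf r 0 (zero_add _)
      (Nat.succ_pos r) (fun j _ z h x => toStrategy_act ψ g hg z h x) (B := fun _ _ _ => 1)
      measurable_const
    have hs : Finset.Ici (⟨0, Nat.succ_pos r⟩ : Fin (r + 1)) = Finset.univ := by
      ext j; simp
    simp only [one_mul, hs] at h
    rw [h]
    simp only [switchCost, not_lt_zero, Finset.filter_false, Finset.sum_empty, lintegral_zero,
      zero_add]
    rfl

/-- The cost-to-go of a Markov strategy has finite expectation in round `i` if it does for the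
strategy that switches to it in that round. -/
theorem visibleIntegral_costToGo_ne_top {g : 𝓩 → ProbabilityMeasure 𝓦} (hg : Measurable g)
    (hμ : IsPosterior μ g) {n : ℕ}
    (hneg : ∀ φ : Strategy 𝓩 𝓧 𝓐, M.NegPartIntegrable n μ ν φ)
    (φ : Strategy 𝓩 𝓧 𝓐) (ψ : MarkovStrategy 𝓦 𝓧 𝓐) {i : ℕ} (hi : i ≤ n) :
    (M.visibleIntegral μ ν φ i fun z _ x => M.costToGo M.lossNeg ψ (n - i) i (g z) x) ≠ ∞ := by
  -- no rounds remain if `i = n`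
  rcases hi.eq_or_lt with rfl | hi
  · simp [costToGo, visibleIntegral]
  obtain ⟨r, hr⟩ : ∃ r, n - i = r + 1 := ⟨n - i - 1, by omega⟩
  set φ' := φ.switch (ψ.toStrategy g hg) i with hφ'
  have hact : ∀ j, i ≤ j → ∀ z (h : Fin j → 𝓧 × 𝓐) x, φ'.act z h x = ψ.est j (g z, x) := by
    intro j hj z h x
    rw [← toStrategy_act ψ g hg z h x]
    simp [Strategy.act, hφ', Strategy.switch, not_lt.2 hj]
  have hlaw : M.law μ ν φ i = M.law μ ν φ' i :=
    M.law_congr μ ν i fun j hj => by simp [hφ', Strategy.switch, hj]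
  have h := M.lintegral_law_costToGo μ ν hg hμ φ' ψ M.measurable_lossNeg r i (by omega) hi hact
    (B := fun _ _ _ => 1) measurable_const
  simp only [one_mul] at h
  rw [visibleIntegral, hlaw, hr]
  refine ne_of_eq_of_ne h.symm ?_
  rw [lintegral_finsetSum _ (by fun_prop)]
  exact ENNReal.sum_ne_top.2 fun j _ => hneg φ' j

/-- Switching after round `i`: conditionally on what is visible in round `i`, the cost of round `i`
and of the later rounds is the cost of the estimate that `φ` makes in round `i`. -/
theorem switchCost_succ {g : 𝓩 → ProbabilityMeasure 𝓦} (hg : Measurable g)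
    (hμ : IsPosterior μ g) (φ : Strategy 𝓩 𝓧 𝓐) (ψ : MarkovStrategy 𝓦 𝓧 𝓐)
    {f : 𝓧 × 𝓨 × 𝓐 → ℝ≥0∞} (hf : Measurable f) {n i r : ℕ} (hir : i + (r + 1) = n) :
    M.switchCost μ ν g φ ψ f n (i + 1)
      = ∫⁻ ω, ∑ j ∈ Finset.univ.filter (fun j : Fin n => (j : ℕ) < i), f (ω.2 j) ∂M.law μ ν φ n
        + M.visibleIntegral μ ν φ i
            fun z h x => M.actionCost f ψ r i (g z) x (φ.act z h x) := by
  have hi : i < n := by omega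
  have hs : (Finset.univ.filter fun j : Fin n => (j : ℕ) < i + 1)
      = insert ⟨i, hi⟩ (Finset.univ.filter fun j : Fin n => (j : ℕ) < i) := by
    ext j
    simp only [Finset.mem_filter, Finset.mem_univ, true_and, Finset.mem_insert, Fin.ext_iff]
    omega
  have hnot : (⟨i, hi⟩ : Fin n) ∉ Finset.univ.filter fun j : Fin n => (j : ℕ) < i := by simp
  have hcost := M.lintegral_law_cost μ ν hg hμ φ hi (B := fun _ _ _ => 1) measurable_const hf
  simp only [one_mul] at hcost
  have hact : Measurable fun q : 𝓩 × (Fin i → 𝓧 × 𝓐) × 𝓧 =>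
      (g q.1, q.2.2, φ.act q.1 q.2.1 q.2.2) :=
    Measurable.prodMk (by fun_prop) (Measurable.prodMk (by fun_prop)
      (φ.measurable_act (by fun_prop) (by fun_prop) (by fun_prop)))
  simp only [switchCost, hs, Finset.sum_insert hnot]
  rw [lintegral_add_left (by fun_prop), hcost, visibleIntegral_succ, show n - (i + 1) = r by omega]
  · simp only [actionCost]
    rw [visibleIntegral_add, add_comm (M.visibleIntegral _ _ _ _ _), add_assoc]
    exact (M.measurable_meanCost hf).comp hact
  · exact (M.measurable_costToGo hf ψ (n - (i + 1)) (i + 1)).comp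
      (f := fun q : 𝓩 × (Fin (i + 1) → 𝓧 × 𝓐) × 𝓧 => (g q.1, q.2.2)) (by fun_prop)

/-- Switching to the strategy of dynamic programming one round earlier does not increase the
expected loss. -/
theorem switchCost_sub_le_succ {g : 𝓩 → ProbabilityMeasure 𝓦} (hg : Measurable g)
    (hμ : IsPosterior μ g) {n : ℕ}
    (hneg : ∀ φ : Strategy 𝓩 𝓧 𝓐, M.NegPartIntegrable n μ ν φ)
    (hneg_tail : ∀ (ψ : MarkovStrategy 𝓦 𝓧 𝓐) (i : Fin n) (π : ProbabilityMeasure 𝓦)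
      (x : 𝓧), (M.tail i).NegPartIntegrable (n - i) (beliefLaw π) (Measure.dirac x)
        (tailStrategy ψ i π))
    {ψs : MarkovStrategy 𝓦 𝓧 𝓐} (hψs : ∀ (i : Fin n) (π : ProbabilityMeasure 𝓦) (x : 𝓧),
      IsMinOn (M.Qstar n i π x) Set.univ (ψs.est i (π, x)))
    (φ : Strategy 𝓩 𝓧 𝓐) {i : ℕ} (hi : i < n) :
    (M.switchCost μ ν g φ ψs M.lossPos n i : EReal) - M.switchCost μ ν g φ ψs M.lossNeg n i
      ≤ (M.switchCost μ ν g φ ψs M.lossPos n (i + 1) : EReal)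
        - M.switchCost μ ν g φ ψs M.lossNeg n (i + 1) := by
  obtain ⟨r, hr⟩ : ∃ r, n - i = r + 1 := ⟨n - i - 1, by omega⟩
  have hir : i + (r + 1) = n := by omega
  have hpast := M.lintegral_sum_lossNeg_ne_top μ ν (hneg φ)
    (Finset.univ.filter fun j : Fin n => (j : ℕ) < i)
  have hgo := M.visibleIntegral_costToGo_ne_top μ ν hg hμ hneg φ ψs hi.le
  have hact : (M.visibleIntegral μ ν φ i
      fun z h x => M.actionCost M.lossNeg ψs r i (g z) x (φ.act z h x)) ≠ ∞ := by
    have h : M.switchCost μ ν g φ ψs M.lossNeg n (i + 1) ≠ ∞ :=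
      ENNReal.add_ne_top.2 ⟨M.lintegral_sum_lossNeg_ne_top μ ν (hneg φ) _,
        M.visibleIntegral_costToGo_ne_top μ ν hg hμ hneg φ ψs (Nat.succ_le_of_lt hi)⟩
    rw [M.switchCost_succ μ ν hg hμ φ ψs M.measurable_lossNeg hir] at h
    exact (ENNReal.add_ne_top.1 h).2
  have hm₁ : ∀ {f : 𝓧 × 𝓨 × 𝓐 → ℝ≥0∞}, Measurable f →
      Measurable fun q : 𝓩 × (Fin i → 𝓧 × 𝓐) × 𝓧 => M.costToGo f ψs (n - i) i (g q.1) q.2.2 :=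
    fun hf => (M.measurable_costToGo hf ψs (n - i) i).comp
      (f := fun q : 𝓩 × (Fin i → 𝓧 × 𝓐) × 𝓧 => (g q.1, q.2.2)) (by fun_prop)
  have hm₂ : ∀ {f : 𝓧 × 𝓨 × 𝓐 → ℝ≥0∞}, Measurable f →
      Measurable fun q : 𝓩 × (Fin i → 𝓧 × 𝓐) × 𝓧 =>
        M.actionCost f ψs r i (g q.1) q.2.2 (φ.act q.1 q.2.1 q.2.2) :=
    fun hf => (M.measurable_actionCost hf ψs r i).comp
      (f := fun q : 𝓩 × (Fin i → 𝓧 × 𝓐) × 𝓧 => (g q.1, q.2.2, φ.act q.1 q.2.1 q.2.2))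
      (Measurable.prodMk (by fun_prop) (Measurable.prodMk (by fun_prop)
        (φ.measurable_act (by fun_prop) (by fun_prop) (by fun_prop))))
  have hv : Measurable fun ω : (𝓦 × 𝓩) × (Fin n → 𝓧 × 𝓨 × 𝓐) =>
      (ω.1.2, visible (truncate hi.le ω.2), (ω.2 ⟨i, hi⟩).1) := by fun_prop
  rw [M.switchCost_succ μ ν hg hμ φ ψs M.measurable_lossPos hir,
    M.switchCost_succ μ ν hg hμ φ ψs M.measurable_lossNeg hir, switchCost, switchCost,
    coe_add_sub_coe_add hpast hgo, coe_add_sub_coe_add hpast hact]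
  refine add_le_add le_rfl ?_
  -- both sides are expectations of functions of what is visible in round `i`, which are compared
  -- pointwise
  have he₁ : ∀ {f : 𝓧 × 𝓨 × 𝓐 → ℝ≥0∞}, Measurable f → _ := fun {f} hf =>
    M.lintegral_law_visible μ ν φ hi (F := fun z _ x => M.costToGo f ψs (n - i) i (g z) x)
      (hm₁ hf)
  have he₂ : ∀ {f : 𝓧 × 𝓨 × 𝓐 → ℝ≥0∞}, Measurable f → _ := fun {f} hf =>
    M.lintegral_law_visible μ ν φ hi
      (F := fun z h x => M.actionCost f ψs r i (g z) x (φ.act z h x)) (hm₂ hf)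
  rw [← he₁ M.measurable_lossNeg] at hgo ⊢
  rw [← he₂ M.measurable_lossNeg] at hact ⊢
  rw [← he₁ M.measurable_lossPos, ← he₂ M.measurable_lossPos]
  refine ((expect_coe_sub_coe ((hm₁ M.measurable_lossPos).comp hv)
    ((hm₁ M.measurable_lossNeg).comp hv) hgo).symm.trans_le (expect_mono fun ω => ?_)).trans_eq
    (expect_coe_sub_coe ((hm₂ M.measurable_lossPos).comp hv)
      ((hm₂ M.measurable_lossNeg).comp hv) hact)
  rw [hr]
  exact M.costToGo_sub_le_actionCost_sub hneg_tail hψs r i hir _ _ _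

/-- Moving the switch from round `n` to round `0` one round at a time shows that the strategy of
dynamic programming is at least as good as an arbitrary one. -/
theorem inferenceLoss_toStrategy_le {g : 𝓩 → ProbabilityMeasure 𝓦} (hg : Measurable g)
    (hμ : IsPosterior μ g) {n : ℕ}
    (hneg : ∀ φ : Strategy 𝓩 𝓧 𝓐, M.NegPartIntegrable n μ ν φ)
    (hneg_tail : ∀ (ψ : MarkovStrategy 𝓦 𝓧 𝓐) (i : Fin n) (π : ProbabilityMeasure 𝓦)
      (x : 𝓧), (M.tail i).NegPartIntegrable (n - i) (beliefLaw π) (Measure.dirac x)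
        (tailStrategy ψ i π))
    {ψs : MarkovStrategy 𝓦 𝓧 𝓐} (hψs : ∀ (i : Fin n) (π : ProbabilityMeasure 𝓦) (x : 𝓧),
      IsMinOn (M.Qstar n i π x) Set.univ (ψs.est i (π, x)))
    (φ : Strategy 𝓩 𝓧 𝓐) :
    M.inferenceLoss n μ ν (ψs.toStrategy g hg) ≤ M.inferenceLoss n μ ν φ := by
  have h : ∀ i, i ≤ n →
      (M.switchCost μ ν g φ ψs M.lossPos n 0 : EReal) - M.switchCost μ ν g φ ψs M.lossNeg n 0
        ≤ (M.switchCost μ ν g φ ψs M.lossPos n i : EReal)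
          - M.switchCost μ ν g φ ψs M.lossNeg n i := fun i => by
    induction i with
    | zero => exact fun _ => le_rfl
    | succ i ih =>
      exact fun hi => (ih (by omega)).trans
        (M.switchCost_sub_le_succ μ ν hg hμ hneg hneg_tail hψs φ hi)
  have hn := h n le_rfl
  rwa [switchCost_self, switchCost_self,
    M.switchCost_zero μ ν hg hμ φ ψs M.measurable_lossPos,
    M.switchCost_zero μ ν hg hμ φ ψs M.measurable_lossNeg,
    ← M.inferenceLoss_eq μ ν (hneg _), ← M.inferenceLoss_eq μ ν (hneg _)] at hn

/-! ### The loss-to-go as a conditional expectation -/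

theorem expect_restrict_lossToGo {g : 𝓩 → ProbabilityMeasure 𝓦} (hg : Measurable g)
    (hμ : IsPosterior μ g) {n : ℕ} (ψ : MarkovStrategy 𝓦 𝓧 𝓐)
    (hneg : M.NegPartIntegrable n μ ν (ψ.toStrategy g hg)) (i : Fin n)
    (hneg_tail : ∀ (π : ProbabilityMeasure 𝓦) (x : 𝓧), (M.tail i).NegPartIntegrable (n - i)
      (beliefLaw π) (Measure.dirac x) (tailStrategy ψ i π))
    {S : Set (ProbabilityMeasure 𝓦 × 𝓧)} (hS : MeasurableSet S) :
    expect ((M.law μ ν (ψ.toStrategy g hg) n).restrict {ω | (g ω.1.2, (ω.2 i).1) ∈ S})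
        (fun ω => ((∑ j ∈ Finset.Ici i, M.roundLoss (ω.2 j) : ℝ) : EReal))
      = expect ((M.law μ ν (ψ.toStrategy g hg) n).restrict {ω | (g ω.1.2, (ω.2 i).1) ∈ S})
        (fun ω => M.lossToGo n ψ i (g ω.1.2) (ω.2 i).1) := by
  have hsum : ∫⁻ ω in {ω | (g ω.1.2, (ω.2 i).1) ∈ S}, ∑ j ∈ Finset.Ici i, M.lossNeg (ω.2 j)
      ∂M.law μ ν (ψ.toStrategy g hg) n ≠ ∞ :=
    ne_top_of_le_ne_top (M.lintegral_sum_lossNeg_ne_top μ ν hneg _) (setLIntegral_le_lintegral _ _)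
  have hm : ∀ {f : 𝓧 × 𝓨 × 𝓐 → ℝ≥0∞}, Measurable f →
      Measurable fun ω : (𝓦 × 𝓩) × (Fin n → 𝓧 × 𝓨 × 𝓐) =>
        M.costToGo f ψ (n - i) i (g ω.1.2) (ω.2 i).1 :=
    fun hf => (M.measurable_costToGo hf ψ (n - i) i).comp
      (f := fun ω : (𝓦 × 𝓩) × (Fin n → 𝓧 × 𝓨 × 𝓐) => (g ω.1.2, (ω.2 i).1)) (by fun_prop)
  have hleft := expect_coe_sum
    (μ := (M.law μ ν (ψ.toStrategy g hg) n).restrict {ω | (g ω.1.2, (ω.2 i).1) ∈ S})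
    (Finset.Ici i) (f := fun j (ω : (𝓦 × 𝓩) × (Fin n → 𝓧 × 𝓨 × 𝓐)) => M.roundLoss (ω.2 j))
    (fun j => by fun_prop)
    (fun j => ne_top_of_le_ne_top (hneg j) (setLIntegral_le_lintegral _ _))
  refine hleft.trans ?_
  simp only [M.lossToGo_eq ψ i.2 _ _ (hneg_tail _ _)]
  have hneg_eq := M.setLIntegral_law_costToGo μ ν hg hμ ψ M.measurable_lossNeg i hS
  rw [expect_coe_sub_coe (hm M.measurable_lossPos) (hm M.measurable_lossNeg) (hneg_eq ▸ hsum),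
    ← hneg_eq, ← M.setLIntegral_law_costToGo μ ν hg hμ ψ M.measurable_lossPos i hS]
  rfl

theorem measurable_lossToGo {n : ℕ} (ψ : MarkovStrategy 𝓦 𝓧 𝓐) (i : Fin n)
    (hneg_tail : ∀ (π : ProbabilityMeasure 𝓦) (x : 𝓧), (M.tail i).NegPartIntegrable (n - i)
      (beliefLaw π) (Measure.dirac x) (tailStrategy ψ i π)) :
    Measurable fun p : ProbabilityMeasure 𝓦 × 𝓧 => M.lossToGo n ψ i p.1 p.2 := by
  simp only [M.lossToGo_eq ψ i.2 _ _ (hneg_tail _ _)]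
  exact (measurable_coe_ennreal_ereal.comp
    (M.measurable_costToGo M.measurable_lossPos ψ (n - i) i)).sub
    (measurable_coe_ennreal_ereal.comp (M.measurable_costToGo M.measurable_lossNeg ψ (n - i) i))

end Model

end DynInf

theorem mainTheorem1 {𝓦 𝓓 𝓧 𝓨 𝓐 : Type*} [MeasurableSpace 𝓦] [StandardBorelSpace 𝓦] [Nonempty 𝓦]
    [MeasurableSpace 𝓓] [MeasurableSpace 𝓧] [MeasurableSpace 𝓨] [MeasurableSpace 𝓐]
    (m n : ℕ) (M : DynInf.Model 𝓦 𝓧 𝓨 𝓐)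
    (PX : Measure 𝓧) [IsProbabilityMeasure PX]
    (PW : Measure 𝓦) [IsProbabilityMeasure PW]
    (PZ : Kernel 𝓦 (Fin m → 𝓓)) [IsMarkovKernel PZ]
    -- the negative parts of the losses are integrable, so that all expectations are well defined
    (hneg : ∀ ψ : DynInf.Strategy (Fin m → 𝓓) 𝓧 𝓐, M.NegPartIntegrable n (PW ⊗ₘ PZ) PX ψ)
    (hneg_tail : ∀ (ψ : DynInf.MarkovStrategy 𝓦 𝓧 𝓐) (i : Fin n) (π : ProbabilityMeasure 𝓦)
      (x : 𝓧), (M.tail i).NegPartIntegrable (n - i) (DynInf.Model.beliefLaw π)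
        (Measure.dirac x) (DynInf.Model.tailStrategy ψ i π))
    (ψs : DynInf.MarkovStrategy 𝓦 𝓧 𝓐)
    (hψs : ∀ (i : Fin n) (π : ProbabilityMeasure 𝓦) (x : 𝓧),
      IsMinOn (M.Qstar n i π x) Set.univ (ψs.est i (π, x))) :
    -- the strategy `ψs` attains the minimum inference loss
    (∀ ψ : DynInf.Strategy (Fin m → 𝓓) 𝓧 𝓐,
      M.inferenceLoss n (PW ⊗ₘ PZ) PX
          (ψs.toStrategy (DynInf.post PW PZ) (DynInf.measurable_post PW PZ))
        ≤ M.inferenceLoss n (PW ⊗ₘ PZ) PX ψ) ∧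
    -- the loss-to-go is the conditional expectation of the remaining loss given the posterior and
    -- the current observation
    (∀ (ψ : DynInf.MarkovStrategy 𝓦 𝓧 𝓐) (i : Fin n),
      Measurable (fun p : ProbabilityMeasure 𝓦 × 𝓧 => M.lossToGo n ψ i p.1 p.2) ∧
      ∀ S : Set (ProbabilityMeasure 𝓦 × 𝓧), MeasurableSet S →
        DynInf.expect ((M.law (PW ⊗ₘ PZ) PX
            (ψ.toStrategy (DynInf.post PW PZ) (DynInf.measurable_post PW PZ)) n).restrict
              {ω | (DynInf.post PW PZ ω.1.2, (ω.2 i).1) ∈ S})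
            (fun ω => ((∑ j ∈ Finset.Ici i, M.roundLoss (ω.2 j) : ℝ) : EReal)) =
          DynInf.expect ((M.law (PW ⊗ₘ PZ) PX
            (ψ.toStrategy (DynInf.post PW PZ) (DynInf.measurable_post PW PZ)) n).restrict
              {ω | (DynInf.post PW PZ ω.1.2, (ω.2 i).1) ∈ S})
            (fun ω => M.lossToGo n ψ i (DynInf.post PW PZ ω.1.2) (ω.2 i).1)) ∧
    -- the loss-to-go of every Markov strategy is at least the dynamic programming value, with
    -- equality for strategies that agree with `ψs` from round `i` on
    (∀ (ψ : DynInf.MarkovStrategy 𝓦 𝓧 𝓐) (i : Fin n) (π : ProbabilityMeasure 𝓦) (x : 𝓧),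
      M.Vstar n i π x ≤ M.lossToGo n ψ i π x ∧
      ((∀ j : Fin n, i ≤ j → ∀ (π' : ProbabilityMeasure 𝓦) (x' : 𝓧),
          ψ.est j (π', x') = ψs.est j (π', x')) →
        M.lossToGo n ψ i π x = M.Vstar n i π x)) := by
  refine ⟨fun ψ => M.inferenceLoss_toStrategy_le _ _ (DynInf.measurable_post PW PZ)
      (DynInf.Model.isPosterior_post PW PZ) hneg hneg_tail hψs ψ,
    fun ψ i => ⟨M.measurable_lossToGo ψ i (hneg_tail ψ i), fun S hS =>
      M.expect_restrict_lossToGo _ _ (DynInf.measurable_post PW PZ)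
        (DynInf.Model.isPosterior_post PW PZ) ψ (hneg _) i (hneg_tail ψ i) hS⟩,
    fun ψ i π x => ⟨M.Vstar_le_lossToGo hneg_tail ψ (n - i - 1) i (by omega) π x,
      fun h => M.lossToGo_eq_Vstar hneg_tail hψs ψ (n - i - 1) i (by omega)
        (fun j hij hj => h ⟨j, hj⟩ hij) π x⟩⟩
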